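/- Let $A$ be a finite alphabet and $\sigma:A\to A^+$ a substitution, extended to words by concatenation. Let $L(\sigma)$ be the set of all factors of the words $\sigma^n(a)$ ($a\in A$, $n\ge 1$), let $X_\sigma=\{x\in A^{\mathbb Z}: x[-n,n]\in L(\sigma)\text{ for all }n\}$ with the product topology, let $T_\sigma$ be the left shift on $X_\sigma$, and let $L(X_\sigma)$ be the set of words that occur in points of $X_\sigma$. Assume that $\sigma$ is aperiodic, that is, $(X_\sigma,T_\sigma)$ has no periodic points, and that $\sigma$ is $m$-primitive for some $m>0$: $A=A_1\sqcup\dots\sqcup A_m\sqcup A_0$ with $|A_i|\ge 2$ for $1\le i\le m$, where (a) $\sigma(A_i)\subset A_i^+$ and $\sigma|_{A_i}$ is primitive for $1\le i\le m$; (b) for each $a\in A$ some letter of $A_1\cup\dots\cup A_m$ occurs in $\sigma^n(a)$ for some $n>0$; (c) $L(\sigma)=L(\sigma^k)$ for all $k\ge1$; (d) $A\subset L(X_\sigma)$. For $1\le i\le m$ let $Z_i$ be the set of $x\in X_\sigma$ such that every $x[-n,n]$ is a factor of some $\sigma^k(a)$ with $a\in A_i$. Then there are $p\ge1$ and $w_i\in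 Z_i$ with $\sigma^p(w_i)=w_i$ for $1\le i\le m$. Fix any such $p$ and $w_1,\dots,w_m$, and put $r_i=w_i[-1]$, $l_i=w_i[0]$. A return word is a word $w\in L(X_\sigma)$ which begins with $l_i$, ends with $r_j$ and satisfies $r_iwl_j\in L(X_\sigma)$ for some $i,j$, and in which none of $r_1l_1,\dots,r_ml_m$ occurs. The set $\mathcal R$ of return words is finite, and there is a unique substitution $\tau:\mathcal R\to\mathcal R^+$ (the derivative substitution) such that $\tau(w)=d_1\dots d_q$, where $\sigma^p(w)$ is the concatenation of the return words $d_1,\dots,d_q$ and, for each $k<q$, the last letter of $d_k$ and the first letter of $d_{k+1}$ are $r_j$ and $l_j$ for some $j$. There is a stationary ordered Bratteli diagram $B=(V,E,\le)$ whose vertices at each level $n\ge1$ are labelled bijectively by $\mathcal R$, on which $\tau$ is read (at each vertex of level $n\ge2$ with label $w$, the labels of the sources of the edges ending there, listed in increasing order, form the word $\tau(w)$), and which has exactly $|w|$ edges between the top vertex and the vertex of level $1$ with label $w$, for each $w\in\mathcal R$. For every such $B$, the space $X_B$ of infinite paths, with the topology generated by cylinder sets, has a Vershik homeomorphism $\varphi_B$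 such that $(X_B,\varphi_B)$ and $(X_\sigma,T_\sigma)$ are topologically conjugate. Here a Vershik homeomorphism is a homeomorphism $\varphi_B$ of $X_B$ which maps the set of maximal paths onto the set of minimal paths and which, for a non-maximal path $x=(x_1,x_2,\dots)$ whose first non-maximal edge is $x_k$, replaces $x_k$ by its successor $\overline{x_k}$ among the edges with the same range, replaces $(x_1,\dots,x_{k-1})$ by the minimal path from the top vertex to the source of $\overline{x_k}$, and keeps $x_{k+1},x_{k+2},\dots$. -/

import Mathlib

universe u v

namespace BratteliSubst

section Substitutions

variable {A : Type u}

/-- A substitution on `A` is a map `A → A⁺`: a map to words, no letter being sent to the empty word. -/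
def IsSubstitution (σ : A → List A) : Prop := ∀ a, σ a ≠ []

/-- The extension of a substitution to words, by concatenation. -/
def onWord (σ : A → List A) (u : List A) : List A := u.flatMap σ

/-- The `n`-th power `σⁿ` of a substitution, with `σ⁰(a) = a`. -/
def power (σ : A → List A) (n : ℕ) (a : A) : List A := (onWord σ)^[n] [a]

/-- The language `L(σ)`: all factors of the words `σⁿ(a)`, `n ≥ 1`. -/
def language (σ : A → List A) : Set (List A) :=
  {u | ∃ (a : A) (n : ℕ), 1 ≤ n ∧ u <:+: power σ n a}

/-- The word `x[k] x[k+1] … x[k+n-1]`. -/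
def factor (x : ℤ → A) (k : ℤ) (n : ℕ) : List A :=
  (List.range n).map fun i => x (k + (i : ℤ))

/-- The substitution space `X_σ`: all `x` with `x[-n,n] ∈ L(σ)` for every `n`.
As a subset of `ℤ → A` it carries the subspace topology of the product topology. -/
def space (σ : A → List A) : Set (ℤ → A) :=
  {x | ∀ n : ℕ, factor x (-(n : ℤ)) (2 * n + 1) ∈ language σ}

/-- The shift. -/
def shift (x : ℤ → A) : ℤ → A := fun k => x (k + 1)

/-- The language `L(X_σ)`: all words that occur in points of `X_σ`. -/
def spaceLanguage (σ : A → List A) : Set (List A) :=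
  {u | ∃ x ∈ space σ, ∃ k : ℤ, factor x k u.length = u}

/-- `σ` is aperiodic: the shift has no periodic point in `X_σ`. -/
def IsAperiodic (σ : A → List A) : Prop :=
  ∀ x ∈ space σ, ∀ n : ℕ, 0 < n → shift^[n] x ≠ x

/-- `y = σ(x)` for two-sided sequences: `σ(x[0]) σ(x[1]) …` is written in `y` from coordinate `0` to
the right, and `… σ(x[-2]) σ(x[-1])` ends at coordinate `-1`. -/
def IsImage (σ : A → List A) (x y : ℤ → A) : Prop :=
  ∀ n : ℕ,
    factor y 0 (onWord σ (factor x 0 n)).length = onWord σ (factor x 0 n) ∧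
    factor y (-((onWord σ (factor x (-(n : ℤ)) n)).length : ℤ))
      (onWord σ (factor x (-(n : ℤ)) n)).length = onWord σ (factor x (-(n : ℤ)) n)

/-- `σ` is `m`-primitive with respect to the decomposition `A = A₁ ⊔ … ⊔ A_m ⊔ A₀`, where `C i` are
the sets `A₁, …, A_m` and `A₀` is the complement of their union. -/
structure IsMPrimitive (σ : A → List A) (m : ℕ) (C : Fin m → Set A) : Prop where
  pos : 0 < m
  disjoint : Pairwise fun i j => Disjoint (C i) (C j)
  two_le : ∀ i, 2 ≤ (C i).ncard
  maps : ∀ i, ∀ a ∈ C i, ∀ b ∈ σ a, b ∈ C i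
  primitive : ∀ i, ∃ n : ℕ, 0 < n ∧ ∀ a ∈ C i, ∀ b ∈ C i, b ∈ power σ n a
  reaches : ∀ a : A, ∃ i, ∃ b ∈ C i, ∃ n : ℕ, 0 < n ∧ b ∈ power σ n a
  language_power : ∀ k : ℕ, 1 ≤ k → language σ = language (power σ k)
  letters : ∀ a : A, [a] ∈ spaceLanguage σ

/-- The minimal component of `X_σ` defined by the primitive restriction of `σ` to `D ⊆ A`: all
`x ∈ X_σ` such that each `x[-n,n]` is a factor of some `σᵏ(a)` with `a ∈ D`. -/
def component (σ : A → List A) (D : Set A) : Set (ℤ → A) :=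
  {x | x ∈ space σ ∧ ∀ n : ℕ, ∃ a ∈ D, ∃ k : ℕ,
    factor x (-(n : ℤ)) (2 * n + 1) <:+: power σ k a}

/-- Base points: one point `w i` in each minimal component, all fixed by the power `σᵖ`, `p ≥ 1`. -/
structure IsBaseChoice (σ : A → List A) {m : ℕ} (C : Fin m → Set A) (p : ℕ)
    (w : Fin m → ℤ → A) : Prop where
  pos : 0 < p
  mem : ∀ i, w i ∈ component σ (C i)
  fixed : ∀ i, IsImage (power σ p) (w i) (w i)

/-- The return words, for `r_i = w_i[-1]` and `l_i = w_i[0]`. -/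
def returnWords (σ : A → List A) {m : ℕ} (w : Fin m → ℤ → A) : Set (List A) :=
  {u | u ∈ spaceLanguage σ ∧
    (∃ i j, [w i (-1)] ++ u ++ [w j 0] ∈ spaceLanguage σ ∧
      u.head? = some (w i 0) ∧ u.getLast? = some (w j (-1))) ∧
    ∀ k, ¬ [w k (-1), w k 0] <:+: u}

/-- `τ` is the derivative substitution of `s` on the return words: `τ(u) = d₁ … d_q` where `s(u)` is
the concatenation of the return words `d₁, …, d_q`, cut at the occurrences of the words `r_j l_j`
(two consecutive `d`'s always meet in some `r_j . l_j`). -/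
structure IsDerivative (σ : A → List A) {m : ℕ} (w : Fin m → ℤ → A) (s : A → List A)
    (τ : returnWords σ w → List (returnWords σ w)) : Prop where
  ne_nil : IsSubstitution τ
  flatten : ∀ u : returnWords σ w, ((τ u).map Subtype.val).flatten = onWord s u.1
  junction : ∀ u : returnWords σ w,
    (τ u).IsChain fun d e => ∃ j, d.1.getLast? = some (w j (-1)) ∧ e.1.head? = some (w j 0)

end Substitutions

/-- An ordered Bratteli diagram; `E n` is the set of edges from level `n` to level `n + 1`. -/
structure OrderedBratteliDiagram where
  V : ℕ → Type v
  E : ℕ → Type v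
  src : ∀ {n}, E n → V n
  rng : ∀ {n}, E n → V (n + 1)
  finite_V : ∀ n, Finite (V n)
  finite_E : ∀ n, Finite (E n)
  top : Nonempty (V 0) ∧ Subsingleton (V 0)
  src_surjective : ∀ n, Function.Surjective (src : E n → V n)
  rng_surjective : ∀ n, Function.Surjective (rng : E n → V (n + 1))
  order : ∀ n, PartialOrder (E n)
  comparable : ∀ {n} (e f : E n), (e ≤ f ∨ f ≤ e) ↔ rng e = rng f

namespace OrderedBratteliDiagram

variable (B : OrderedBratteliDiagram.{v})

instance (n : ℕ) : PartialOrder (B.E n) := B.order n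

/-- The space `X_B` of infinite paths from the top vertex. -/
def PathSpace : Type v := {x : ∀ n, B.E n // ∀ n, B.rng (x n) = B.src (x (n + 1))}

/-- The topology generated by the cylinder sets. -/
instance : TopologicalSpace B.PathSpace :=
  TopologicalSpace.generateFrom
    {U | ∃ (x : B.PathSpace) (n : ℕ), U = {y : B.PathSpace | ∀ i < n, y.1 i = x.1 i}}

/-- Maximal paths. Edges are comparable exactly when they have the same range, so a maximal element
of `E n` is an edge that is maximal among those with its range. -/
def maxPaths : Set B.PathSpace := {x | ∀ n, IsMax (x.1 n)}

/-- Minimal paths. -/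
def minPaths : Set B.PathSpace := {x | ∀ n, IsMin (x.1 n)}

/-- `φ` is a Vershik homeomorphism of `X_B`: it maps maximal paths onto minimal paths, and at the
first non-maximal edge `x k` of `x` it passes to the successor of `x k`, leaves the later edges
unchanged and makes the earlier ones minimal. -/
structure IsVershik (φ : B.PathSpace ≃ₜ B.PathSpace) : Prop where
  max_min : φ '' B.maxPaths = B.minPaths
  step : ∀ (x : B.PathSpace) (k : ℕ), (∀ i < k, IsMax (x.1 i)) → ¬ IsMax (x.1 k) →
    (∀ i < k, IsMin ((φ x).1 i)) ∧ x.1 k ⋖ (φ x).1 k ∧ ∀ i, k < i → (φ x).1 i = x.1 i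

/-- `B` is stationary ordered, with the vertices of each level `≥ 1` labelled bijectively by `R`, and
`τ` is the substitution read on `B`: for each vertex of level `≥ 2` with label `a`, the labels of the
sources of the edges that end there, listed in increasing order, form the word `τ(a)`. -/
def IsRead {R : Type u} (lab : ∀ n, B.V (n + 1) ≃ R) (τ : R → List R) : Prop :=
  ∀ (n : ℕ) (x : B.V (n + 1 + 1)), ∃ es : List (B.E (n + 1)),
    es.Pairwise (· < ·) ∧ (∀ e, e ∈ es ↔ B.rng e = x) ∧
    es.map (fun e => lab n (B.src e)) = τ (lab (n + 1) x)

/-- There are `h a` edges between the top vertex and the vertex of level `1` with label `a`. -/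
def HasTopEdges {R : Type u} (lab : ∀ n, B.V (n + 1) ≃ R) (h : R → ℕ) : Prop :=
  ∀ a : R, Nat.card {e : B.E 0 // lab 0 (B.rng e) = a} = h a

end OrderedBratteliDiagram

end BratteliSubst

open BratteliSubst

/-! Cutting a point of `X_σ` at all occurrences of the words `r_j . l_j` turns it into a sequence of
return words, and `σᵖ` acts on such sequences as `τ`. Desubstituting by `τ` again and again attaches
to the point a tower: at every level, the word that covers the origin and the offset of the origin
in it. These data are precisely an infinite path of `B`: the words are its vertices and the offsets
pick its edges. The shift increases the offset at the lowest level by one, with carry, and this is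
the Vershik map. It remains to see that the coding of points by paths is a well-defined
homeomorphism.

Well-definedness is uniqueness of desubstitution, that is, recognizability of `σᵖ` on `X_σ`, from
which that of `τ` follows. It holds for every nonerasing morphism `f` mapping an aperiodic system
onto itself up to shifts (`IsAperiodicSystem.recognizable`), by induction on the alphabet. If `f = h
∘ g` passes through fewer letters, the question is moved to `g ∘ h`. Otherwise `f` is elementary,
and by the graph lemma (`factorsThrough_card_quot_link`) two parses of one point without a common
cut drive each other deterministically; finitely many states then force a period.

Injectivity (`IsTower.injective`): the path fixes the word `σᵖⁿ(u)` around the origin. The last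
letter `r_j` of `u` determines `j`, since the base points lie over disjoint alphabets, so `σᵖⁿ(l_j)`
must follow; symmetrically on the left. These words grow with `n`, so all coordinates are
determined. Surjectivity follows by compactness from finite pieces of a path. A limit of towers is a
tower, so uniqueness gives continuity, and a continuous bijection from a compact space to a
Hausdorff space is a homeomorphism. -/

namespace BratteliSubst

/-! ### Finite windows of two-sided sequences. -/

section Factor

variable {A B : Type*}

theorem factor_eq_map (x : ℤ → A) (k : ℤ) (n : ℕ) :
    factor x k n = (List.range n).map fun i : ℕ => x (k + (i : ℤ)) := by
  simp only [factor, List.bind_eq_flatMap, List.pure_def, ← List.map_eq_flatMap, List.map_map]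
  rfl

@[simp] theorem length_factor (x : ℤ → A) (k : ℤ) (n : ℕ) : (factor x k n).length = n := by
  simp [factor_eq_map]

theorem getElem?_factor (x : ℤ → A) (k : ℤ) (n i : ℕ) :
    (factor x k n)[i]? = if i < n then some (x (k + i)) else none := by
  rw [factor_eq_map]
  split_ifs with h
  · simp [h]
  · simp; omega

theorem factor_add (x : ℤ → A) (k : ℤ) (m n : ℕ) :
    factor x k (m + n) = factor x k m ++ factor x (k + m) n := by
  simp [factor_eq_map, List.range_add, add_assoc]

@[simp] theorem factor_zero (x : ℤ → A) (k : ℤ) : factor x k 0 = [] := rfl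

@[simp] theorem factor_one (x : ℤ → A) (k : ℤ) : factor x k 1 = [x k] := by
  simp [factor]

theorem factor_succ (x : ℤ → A) (k : ℤ) (n : ℕ) :
    factor x k (n + 1) = x k :: factor x (k + 1) n := by
  rw [add_comm, factor_add]; simp

theorem factor_succ' (x : ℤ → A) (k : ℤ) (n : ℕ) :
    factor x k (n + 1) = factor x k n ++ [x (k + n)] := by
  rw [factor_add]; simp

theorem factor_congr {x x' : ℤ → A} {k k' : ℤ} {n : ℕ}
    (h : ∀ i : ℕ, i < n → x (k + i) = x' (k' + i)) : factor x k n = factor x' k' n := by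
  rw [factor_eq_map, factor_eq_map]
  exact List.map_congr_left fun i hi => h i (List.mem_range.1 hi)

theorem eq_of_factor_eq {x x' : ℤ → A} {k k' : ℤ} {n : ℕ}
    (h : factor x k n = factor x' k' n) {i : ℕ} (hi : i < n) : x (k + i) = x' (k' + i) := by
  have := congrArg (fun l : List A => l[i]?) h
  simpa only [getElem?_factor, hi, if_true, Option.some.injEq] using this

theorem factor_translate (x : ℤ → A) (k t : ℤ) (n : ℕ) :
    factor (fun i => x (i + t)) k n = factor x (k + t) n :=
  factor_congr fun i _ => by congr 1; ring

theorem factor_infix (x : ℤ → A) {k k' : ℤ} {n n' : ℕ} (h : k ≤ k') (h' : k' + n' ≤ k + n) :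
    factor x k' n' <:+: factor x k n := by
  obtain ⟨a, rfl⟩ : ∃ a : ℕ, k' = k + a := ⟨(k' - k).toNat, by omega⟩
  obtain ⟨b, rfl⟩ : ∃ b : ℕ, n = a + n' + b := ⟨n - a - n', by omega⟩
  exact ⟨factor x k a, factor x (k + (a + n' : ℕ)) b, by rw [factor_add, factor_add]⟩

theorem exists_factor_of_infix {x : ℤ → A} {k : ℤ} {n : ℕ} {u : List A}
    (h : u <:+: factor x k n) :
    ∃ k', k ≤ k' ∧ k' + u.length ≤ k + n ∧ factor x k' u.length = u := by
  obtain ⟨s, t, h⟩ := h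
  have hl := congrArg List.length h
  simp at hl
  refine ⟨k + s.length, by omega, by omega, ?_⟩
  rw [← hl, ← add_assoc, factor_add, factor_add] at h
  have h1 := List.append_inj_left h (by simp)
  exact (List.append_inj_right h1 (by simp)).symm

theorem factor_eq_append {x : ℤ → A} {k : ℤ} {u v : List A} {n : ℕ}
    (h : factor x k n = u ++ v) :
    factor x k u.length = u ∧ factor x (k + u.length) v.length = v := by
  have hl := congrArg List.length h
  simp at hl
  rw [hl, factor_add] at h
  exact List.append_inj h (by simp)

end Factor

/-! ### Parses: two-sided sequences as concatenations of image words. -/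

section Parse

variable {A B D : Type*}

/-- `x` is the concatenation of the words `f (y i)`, the word `f (y i)` being written from
coordinate `c i` on. -/
structure Parse (f : A → List B) (y : ℤ → A) (c : ℤ → ℤ) (x : ℤ → B) : Prop where
  step : ∀ i, c (i + 1) = c i + (f (y i)).length
  word : ∀ i, factor x (c i) (f (y i)).length = f (y i)

namespace Parse

variable {f : A → List B} {y : ℤ → A} {c : ℤ → ℤ} {x : ℤ → B}

theorem step_nat (h : Parse f y c x) (i : ℤ) (n : ℕ) :
    c (i + n) = c i + ((factor y i n).flatMap f).length := by
  induction n with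
  | zero => simp
  | succ n ih =>
    have := h.step (i + n)
    rw [factor_succ', List.flatMap_append, List.length_append]
    push_cast
    rw [← add_assoc, this, ih]
    simp [add_assoc]

theorem word_nat (h : Parse f y c x) (i : ℤ) (n : ℕ) :
    factor x (c i) ((factor y i n).flatMap f).length = (factor y i n).flatMap f := by
  induction n with
  | zero => simp
  | succ n ih =>
    rw [factor_succ', List.flatMap_append, List.length_append, factor_add, ih, ← h.step_nat]
    congr 1
    simpa using h.word (i + n)

theorem strictMono (hf : ∀ a, f a ≠ []) (h : Parse f y c x) : StrictMono c := by
  apply strictMono_int_of_lt_succ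
  intro i
  have := List.length_pos_iff.2 (hf (y i))
  rw [h.step]; omega

theorem add_le (hf : ∀ a, f a ≠ []) (h : Parse f y c x) (i : ℤ) (n : ℕ) : c i + n ≤ c (i + n) := by
  induction n with
  | zero => simp
  | succ n ih =>
    have := h.strictMono hf (show i + n < i + (n + 1 : ℕ) by push_cast; omega)
    push_cast at *; omega

theorem exists_index (hf : ∀ a, f a ≠ []) (h : Parse f y c x) (k : ℤ) :
    ∃ i, c i ≤ k ∧ k < c (i + 1) := by
  have hbdd : ∃ b : ℤ, ∀ z, c z ≤ k → z ≤ b := by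
    refine ⟨(k - c 0).toNat, fun z hz => ?_⟩
    by_contra! hlt
    have h1 := h.add_le hf 0 (k - c 0).toNat
    have h2 := h.strictMono hf hlt
    simp only [zero_add] at h1
    omega
  have hne : ∃ z, c z ≤ k := by
    refine ⟨-((c 0 - k).toNat : ℤ), ?_⟩
    have h1 := h.add_le hf (-((c 0 - k).toNat : ℤ)) (c 0 - k).toNat
    simp only [neg_add_cancel] at h1
    omega
  obtain ⟨i, hi, hmax⟩ := Int.exists_greatest_of_bdd hbdd hne
  refine ⟨i, hi, ?_⟩
  by_contra! hlt
  have := hmax _ hlt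
  omega

theorem index_unique (hc : StrictMono c) {i j k : ℤ}
    (hi : c i ≤ k) (hi' : k < c (i + 1)) (hj : c j ≤ k) (hj' : k < c (j + 1)) : i = j := by
  have h1 : i < j + 1 := hc.lt_iff_lt.1 (by omega)
  have h2 : j < i + 1 := hc.lt_iff_lt.1 (by omega)
  omega

theorem reindex (h : Parse f y c x) (k : ℤ) :
    Parse f (fun i => y (i + k)) (fun i => c (i + k)) x :=
  ⟨fun i => by rw [show i + 1 + k = i + k + 1 by ring, h.step], fun i => h.word _⟩

theorem translate (h : Parse f y c x) (k : ℤ) :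
    Parse f y (fun i => c i - k) (fun i => x (i + k)) :=
  ⟨fun i => by rw [h.step]; ring, fun i => by
    rw [factor_translate, sub_add_cancel, h.word]⟩

theorem getElem?_word (h : Parse f y c x) {i : ℤ} {j : ℕ} (hj : j < (f (y i)).length) :
    (f (y i))[j]? = some (x (c i + j)) := by
  have := congrArg (fun l : List B => l[j]?) (h.word i)
  simpa only [getElem?_factor, hj, if_true] using this.symm

/-- Two parses that read the same letters on `[a, b)` have the same cuts there. -/
theorem agree_cut {y' : ℤ → A} {c' : ℤ → ℤ} {x' : ℤ → B} (h : Parse f y c x)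
    (h' : Parse f y' c' x') (h0 : c 0 = c' 0) {a b : ℤ} (ha : a ≤ 0) (hb : 0 ≤ b)
    (hy : ∀ i, a ≤ i → i < b → y i = y' i) :
    ∀ i, a ≤ i → i ≤ b → c i = c' i := by
  have hpos : ∀ i, 0 ≤ i → i ≤ b → c i = c' i := by
    intro i hi
    induction i, hi using Int.leInduction with
    | base => exact fun _ => h0
    | succ i hi ih =>
      intro hn
      rw [h.step, h'.step, ih (by omega), hy _ (by omega) (by omega)]
  have hneg : ∀ i, i ≤ 0 → a ≤ i → c i = c' i := by
    intro i hi
    induction i, hi using Int.leInductionDown with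
    | base => exact fun _ => h0
    | pred i hi ih =>
      intro hn
      have h1 := h.step (i - 1)
      have h2 := h'.step (i - 1)
      rw [sub_add_cancel] at h1 h2
      rw [ih (by omega), hy _ hn (by omega)] at h1
      exact add_right_cancel (h1.symm.trans h2)
  intro i hia hib
  rcases le_total 0 i with h0 | h0
  · exact hpos i h0 hib
  · exact hneg i h0 hia

/-- Two parses that read the same letters on `[a, b)` agree there. -/
theorem agree {y' : ℤ → A} {c' : ℤ → ℤ} {x' : ℤ → B} (h : Parse f y c x)
    (h' : Parse f y' c' x') (h0 : c 0 = c' 0) {a b : ℤ} (ha : a ≤ 0) (hb : 0 ≤ b)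
    (hy : ∀ i, a ≤ i → i < b → y i = y' i) :
    (∀ i, a ≤ i → i ≤ b → c i = c' i) ∧ ∀ k, c a ≤ k → k < c b → x k = x' k := by
  have hc := h.agree_cut h' h0 ha hb hy
  refine ⟨hc, fun k hk hk' => ?_⟩
  obtain ⟨n, rfl⟩ : ∃ n : ℕ, b = a + n := ⟨(b - a).toNat, by omega⟩
  have hw := h.word_nat a n
  have hw' := h'.word_nat a n
  have hyn : factor y a n = factor y' a n :=
    factor_congr fun i hi => hy _ (by omega) (by omega)
  rw [← hyn, ← hc a le_rfl (by omega)] at hw'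
  rw [h.step_nat] at hk'
  obtain ⟨t, rfl⟩ : ∃ t : ℕ, k = c a + t := ⟨(k - c a).toNat, by omega⟩
  exact eq_of_factor_eq (hw.trans hw'.symm) (by omega)

theorem unique (hf : ∀ a, f a ≠ []) {c' : ℤ → ℤ} {x' : ℤ → B} (h : Parse f y c x)
    (h' : Parse f y c' x') (h0 : c 0 = c' 0) : c = c' ∧ x = x' := by
  constructor
  · funext i
    exact (h.agree h' h0 (a := -|i|) (b := |i|) (by simp) (by simp) fun _ _ _ => rfl).1 i
      (neg_abs_le i) (le_abs_self i)
  · funext k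
    obtain ⟨i, hi, hi'⟩ := h.exists_index hf k
    have hm := h.strictMono hf
    refine (h.agree h' h0 (a := -|i|) (b := |i + 1|) (by simp) (by simp) fun _ _ _ => rfl).2 k
      (le_trans (hm.monotone (neg_abs_le i)) hi) (lt_of_lt_of_le hi' (hm.monotone (le_abs_self _)))

/-- Every sequence has an image under a nonerasing morphism. -/
theorem exists_image (hf : ∀ a, f a ≠ []) (y : ℤ → A) (k : ℤ) :
    ∃ c x, c 0 = k ∧ Parse f y c x := by
  let L : ℤ → ℤ := fun i => (f (y i)).length
  let c : ℤ → ℤ := fun i => k + ∑ j ∈ Finset.Ico 0 i, L j - ∑ j ∈ Finset.Ico i 0, L j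
  have hc : ∀ i, c (i + 1) = c i + L i := by
    intro i
    simp only [c]
    rcases le_or_gt 0 i with h | h
    · rw [Finset.Ico_eq_empty (a := i) (by omega), Finset.Ico_eq_empty (a := i + 1) (by omega),
        ← Finset.insert_Ico_right_eq_Ico_add_one h, Finset.sum_insert (by simp)]
      simp; ring
    · rw [Finset.Ico_eq_empty (b := i) (by omega), Finset.Ico_eq_empty (b := i + 1) (by omega),
        ← Finset.insert_Ico_add_one_left_eq_Ico h, Finset.sum_insert (by simp)]
      simp only [Finset.sum_empty]; ring
  have hL : ∀ i, 0 < L i := fun i => by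
    have := List.length_pos_iff.2 (hf (y i)); simp only [L]; omega
  have hm : StrictMono c := strictMono_int_of_lt_succ fun i => by rw [hc]; linarith [hL i]
  have hex : ∀ t, ∃ b, ∃ i, ∃ j : ℕ, c i + j = t ∧ (f (y i))[j]? = some b := by
    intro t
    -- `x` is not yet available, so the word covering `t` is located in a parse with the same
    -- lengths over a one-letter alphabet.
    let z : Parse (fun a : A => List.replicate (f a).length ()) y c (fun _ => ()) :=
      ⟨fun i => by simpa using hc i, fun i => by
        apply List.ext_getElem <;> simp⟩
    obtain ⟨i, hi, hi'⟩ := z.exists_index (fun a => by simpa using hf a) t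
    have hlt : (t - c i).toNat < (f (y i)).length := by
      have := hc i; simp only [L] at this; omega
    exact ⟨(f (y i))[(t - c i).toNat], i, (t - c i).toNat, by omega, by simp⟩
  choose x hx using hex
  refine ⟨c, x, by simp [c], hc, fun i => ?_⟩
  apply List.ext_getElem?
  intro j
  rw [getElem?_factor]
  split_ifs with hj
  · obtain ⟨i', j', h1, h2⟩ := hx (c i + j)
    obtain ⟨hj', -⟩ := List.getElem?_eq_some_iff.1 h2
    have h3 := hc i; have h4 := hc i'
    simp only [L] at h3 h4
    have : i' = i := index_unique hm (k := c i + j) (by omega) (by omega) (by omega) (by omega)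
    subst this
    obtain rfl : j' = j := by omega
    exact h2.symm
  · simp; omega

theorem comp {g : B → List D} {d : ℤ → ℤ} {z : ℤ → D} (h : Parse g x d z) (h' : Parse f y c x) :
    Parse (fun a => (f a).flatMap g) y (fun i => d (c i)) z := by
  refine ⟨fun i => ?_, fun i => ?_⟩
  · rw [h'.step, h.step_nat, h'.word]
  · have := h.word_nat (c i) (f (y i)).length
    rwa [h'.word] at this

/-- The intermediate sequence is rebuilt as an image of `y` under `f` and then mapped by `g`,
anchored at `b 0`; uniqueness of parses identifies the result with `z`. -/
theorem decomp {g : B → List D} {z : ℤ → D} {b : ℤ → ℤ} (hf : ∀ a, f a ≠ []) (hg : ∀ a, g a ≠ [])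
    (h : Parse (fun a => (f a).flatMap g) y b z) :
    ∃ c x d, Parse f y c x ∧ Parse g x d z ∧ ∀ i, b i = d (c i) := by
  obtain ⟨c, x, hc0, hp⟩ := exists_image hf y 0
  obtain ⟨d, z', hd0, hq⟩ := exists_image hg x (b 0)
  obtain ⟨h1, h2⟩ := h.unique (by
    intro a ha
    rw [List.flatMap_eq_nil_iff] at ha
    obtain ⟨b, hb⟩ := List.exists_mem_of_ne_nil _ (hf a)
    exact hg b (ha b hb)) (hq.comp hp) (by simp [hc0, hd0])
  subst h2
  exact ⟨c, x, d, hp, hq, fun i => congrFun h1 i⟩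

end Parse

theorem flatMap_ne_nil {f : A → List B} (hf : ∀ a, f a ≠ []) {u : List A} (hu : u ≠ []) :
    u.flatMap f ≠ [] := by
  intro h
  rw [List.flatMap_eq_nil_iff] at h
  obtain ⟨b, hb⟩ := List.exists_mem_of_ne_nil _ hu
  exact hf b (h b hb)

theorem length_le_length_flatMap {f : A → List B} (hf : ∀ a, f a ≠ []) (u : List A) :
    u.length ≤ (u.flatMap f).length := by
  induction u with
  | nil => simp
  | cons a u ih =>
    have := List.length_pos_iff.2 (hf a)
    simp only [List.flatMap_cons, List.length_append, List.length_cons]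
    omega

end Parse

/-! ### The graph lemma: factoring a morphism by linked letters. -/

section GraphLemma

theorem exists_forall_of_antitone {α : Type*} [Finite α] {P : ℕ → α → Prop}
    (hP : ∀ M N e, M ≤ N → P N e → P M e) (h : ∀ N, ∃ e, P N e) : ∃ e, ∀ N, P N e := by
  by_contra! hcon
  choose F hF using hcon
  obtain ⟨N, hN⟩ := (Set.finite_range F).bddAbove
  obtain ⟨e, he⟩ := h N
  exact hF e (hP _ _ e (hN ⟨e, rfl⟩) he)

theorem prefix_or_prefix_of_append {B : Type*} {p q s t : List B}
    (h : p ++ s <+: q ++ t ∨ q ++ t <+: p ++ s) : p <+: q ∨ q <+: p := by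
  rcases h with h | h
  · exact List.prefix_or_prefix_of_prefix ((List.prefix_append p s).trans h)
      (List.prefix_append q t)
  · exact List.prefix_or_prefix_of_prefix (List.prefix_append p s)
      ((List.prefix_append q t).trans h)

/-- The letters `a` and `b` are linked if there are arbitrarily long words beginning with `a` and
`b` whose images are comparable for the prefix order. -/
def Link {A B : Type*} (f : A → List B) (a b : A) : Prop :=
  ∀ N : ℕ, ∃ u v : List A, N ≤ u.length ∧ N ≤ v.length ∧
    ((a :: u).flatMap f <+: (b :: v).flatMap f ∨ (b :: v).flatMap f <+: (a :: u).flatMap f)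

variable {B : Type v}

theorem Link.symm {A : Type*} {f : A → List B} {a b : A} (h : Link f a b) : Link f b a :=
  fun N => let ⟨u, v, h1, h2, h3⟩ := h N
    ⟨v, u, h2, h1, h3.symm⟩

theorem flatMap_flatMap_of_eq {A A' : Type*} {f : A → List B} {g : A → List A'}
    {h : A' → List B} (hfg : ∀ a, f a = (g a).flatMap h) (u : List A) :
    u.flatMap f = (u.flatMap g).flatMap h := by
  rw [List.flatMap_assoc]
  congr 1
  funext a
  exact hfg a

/-- Words do not get shorter under the nonerasing map `hd :: tl`, so the requirement of arbitrarily
long continuations survives. -/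
theorem Link.map {A A' : Type*} {f : A → List B} {f' : A' → List B} {hd : A → A'}
    {tl : A → List A'} (hf : ∀ a, f a = (hd a :: tl a).flatMap f') {a b : A}
    (h : Link f a b) : Link f' (hd a) (hd b) := by
  intro N
  obtain ⟨u, v, hu, hv, huv⟩ := h N
  refine ⟨tl a ++ u.flatMap fun c => hd c :: tl c, tl b ++ v.flatMap fun c => hd c :: tl c,
    ?_, ?_, ?_⟩
  · have := length_le_length_flatMap (f := fun c => hd c :: tl c) (by simp) u
    rw [List.length_append]; omega
  · have := length_le_length_flatMap (f := fun c => hd c :: tl c) (by simp) v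
    rw [List.length_append]; omega
  · rw [flatMap_flatMap_of_eq hf, flatMap_flatMap_of_eq hf] at huv
    simpa using huv

/-- `f` factors through an alphabet with at most `k` letters. -/
def FactorsThrough {A : Type u} (f : A → List B) (k : ℕ) : Prop :=
  ∃ (K : Type u) (_ : Finite K) (g : A → List K) (h : K → List B),
    (∀ a, g a ≠ []) ∧ (∀ a, h a ≠ []) ∧ (∀ a, f a = (g a).flatMap h) ∧ Nat.card K ≤ k

/-- The inductive step of the graph lemma: `hd` induces a map of connected components, and its
surjectivity carries the bound for `f'` over to `f`. -/
theorem FactorsThrough.of_map {A A' : Type u} [Finite A] {f : A → List B} {f' : A' → List B}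
    {hd : A → A'} {tl : A → List A'} (hf : ∀ a, f a = (hd a :: tl a).flatMap f')
    (hsurj : ∀ a', ∃ a, Quot.mk (Link f') (hd a) = Quot.mk (Link f') a')
    (h : FactorsThrough f' (Nat.card (Quot (Link f')))) :
    FactorsThrough f (Nat.card (Quot (Link f))) := by
  obtain ⟨K, hK, g, k, hg, hk, hgk, hcard⟩ := h
  refine ⟨K, hK, fun a => (hd a :: tl a).flatMap g, k, fun a => flatMap_ne_nil hg (by simp), hk,
    fun a => by rw [hf, flatMap_flatMap_of_eq hgk], hcard.trans ?_⟩
  refine Nat.card_le_card_of_surjective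
    (Quot.map (ra := Link f) (rb := Link f') hd fun a b hab => hab.map hf) ?_
  intro q
  induction q using Quot.ind with
  | mk a' =>
    obtain ⟨a, ha⟩ := hsurj a'
    exact ⟨Quot.mk _ a, ha⟩

/-- The graph lemma: a nonerasing morphism factors through an alphabet with as many letters as
there are connected components of the graph of linked letters. -/
theorem factorsThrough_card_quot_link {A : Type u} [Finite A] (f : A → List B)
    (hf : ∀ a, f a ≠ []) : FactorsThrough f (Nat.card (Quot (Link f))) := by
  classical
  cases nonempty_fintype A
  -- The induction is on the total length of the images; the alphabet varies because letters are
  -- deleted.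
  obtain ⟨n, hn⟩ : ∃ n, ∑ a, (f a).length ≤ n := ⟨_, le_rfl⟩
  induction n generalizing A f with
  | zero =>
    have : IsEmpty A := ⟨fun a => by
      have h1 := List.length_pos_iff.2 (hf a)
      have h2 := Finset.single_le_sum (f := fun a => (f a).length) (fun _ _ => Nat.zero_le _)
        (Finset.mem_univ a)
      omega⟩
    exact ⟨A, inferInstance, fun a => [a], f, by simp, hf, by simp, by simp⟩
  | succ n ih =>
    by_cases htriv : ∀ a b, Link f a b → a = b
    · exact ⟨A, inferInstance, fun a => [a], f, by simp, hf, by simp,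
        Nat.card_le_card_of_surjective (Quot.lift id htriv) fun a => ⟨Quot.mk _ a, rfl⟩⟩
    push Not at htriv
    obtain ⟨a, b, ⟨v, hv⟩, hl, hne⟩ : ∃ a b, (∃ v, f b = f a ++ v) ∧ Link f a b ∧ a ≠ b := by
      obtain ⟨a, b, hl, hne⟩ := htriv
      obtain ⟨u, v, -, -, h⟩ := hl 0
      rw [List.flatMap_cons, List.flatMap_cons] at h
      rcases prefix_or_prefix_of_append h with ⟨t, ht⟩ | ⟨t, ht⟩
      · exact ⟨a, b, ⟨t, ht.symm⟩, hl, hne⟩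
      · exact ⟨b, a, ⟨t, ht.symm⟩, hl.symm, hne.symm⟩
    have hsplit : ∑ c, (f c).length = (f b).length + ∑ c ∈ Finset.univ.erase b, (f c).length :=
      (Finset.add_sum_erase _ _ (Finset.mem_univ b)).symm
    have hposb := List.length_pos_iff.2 (hf b)
    have hposa := List.length_pos_iff.2 (hf a)
    -- Two letters with the same image are merged. Otherwise `b` is sent to `a b` and keeps only the
    -- remainder `v` as its image. Both moves shorten the total length.
    by_cases hv0 : v = []
    · subst hv0
      rw [List.append_nil] at hv
      refine FactorsThrough.of_map (A' := {c : A // c ≠ b}) (f' := fun c => f c)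
        (hd := fun c => if h : c = b then ⟨a, hne⟩ else ⟨c, h⟩) (tl := fun _ => []) ?_ ?_ ?_
      · intro c
        by_cases h : c = b <;> simp [h, hv]
      · intro c
        exact ⟨c.1, by simp [c.2]⟩
      · refine ih (A := {c : A // c ≠ b}) _ (fun c => hf c) inferInstance ?_
        have : ∑ c : {c : A // c ≠ b}, (f c).length =
            ∑ c ∈ Finset.univ.erase b, (f c).length :=
          (Finset.sum_subtype _ (by simp) fun c => (f c).length).symm
        omega
    · let f' : A → List B := Function.update f b v
      have hf'b : f' b = v := Function.update_self ..
      have hf'n : ∀ c, c ≠ b → f' c = f c := fun c hc => Function.update_of_ne hc ..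
      let hd : A → A := fun c => if c = b then a else c
      let tl : A → List A := fun c => if c = b then [b] else []
      have hft : ∀ c, f c = (hd c :: tl c).flatMap f' := by
        intro c
        by_cases h : c = b
        · simp [hd, tl, h, hf'b, hf'n _ hne, hv]
        · simp [hd, tl, h, hf'n _ h]
      have hhd : ∀ c, hd c ≠ b := by
        intro c
        by_cases h : c = b <;> simp [hd, h, hne]
      refine FactorsThrough.of_map hft ?_ (ih f' ?_ inferInstance ?_)
      · intro c
        by_cases h : c = b
        · subst h
          -- Only `b` is missed by `hd`, so its component must contain another letter. Cancelling `f
          -- a` in the link of `a` and `b` compares `v` with the image of a continuation; that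
          -- continuation begins with some `hd e0 ≠ b`.
          obtain ⟨e, he⟩ : ∃ e, ∀ N, e ≠ c ∧ ∃ u v : List A, N ≤ u.length ∧ N ≤ v.length ∧
              ((e :: u).flatMap f' <+: (c :: v).flatMap f' ∨
                (c :: v).flatMap f' <+: (e :: u).flatMap f') := by
            refine exists_forall_of_antitone ?_ ?_
            · rintro M N e hMN ⟨he, u, v, hu, hv, h⟩
              exact ⟨he, u, v, hMN.trans hu, hMN.trans hv, h⟩
            · intro N
              -- One letter of `u` is used up as the new first letter, hence `N + 1`.
              obtain ⟨u, v', hu, hv', h⟩ := hl (N + 1)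
              rw [List.flatMap_cons, List.flatMap_cons, hv, List.append_assoc,
                List.prefix_append_right_inj, List.prefix_append_right_inj] at h
              obtain ⟨e0, u, rfl⟩ := List.exists_cons_of_ne_nil
                (List.ne_nil_of_length_pos (show 0 < u.length by omega))
              refine ⟨hd e0, hhd e0, tl e0 ++ u.flatMap fun c => hd c :: tl c,
                v'.flatMap fun c => hd c :: tl c, ?_, ?_, ?_⟩
              · have := length_le_length_flatMap (f := fun c => hd c :: tl c) (by simp) u
                rw [List.length_append]
                simp only [List.length_cons] at hu
                omega
              · have := length_le_length_flatMap (f := fun c => hd c :: tl c) (by simp) v'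
                omega
              · rw [flatMap_flatMap_of_eq hft, flatMap_flatMap_of_eq hft] at h
                simpa [hf'b] using h
          exact ⟨e, by
            simp only [hd, if_neg (he 0).1]
            exact Quot.sound fun N => (he N).2⟩
        · exact ⟨c, by simp [hd, h]⟩
      · intro c
        by_cases h : c = b
        · rw [h, hf'b]; exact hv0
        · rw [hf'n c h]; exact hf c
      · have h1 : ∑ c, (f' c).length = (f' b).length + ∑ c ∈ Finset.univ.erase b, (f' c).length :=
          (Finset.add_sum_erase _ _ (Finset.mem_univ b)).symm
        have h2 : ∑ c ∈ Finset.univ.erase b, (f' c).length =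
            ∑ c ∈ Finset.univ.erase b, (f c).length :=
          Finset.sum_congr rfl fun c hc => by rw [hf'n c (Finset.ne_of_mem_erase hc)]
        have h3 := congrArg List.length hv
        rw [List.length_append] at h3
        rw [hf'b] at h1
        omega

end GraphLemma

/-! ### Recognizability of elementary morphisms. -/

section Elementary

variable {A : Type u} {B : Type v}

/-- `f` does not factor through a smaller alphabet. -/
def Elementary (f : A → List B) : Prop := ∀ k, FactorsThrough f k → Nat.card A ≤ k

theorem FactorsThrough.reverse {f : A → List B} {k : ℕ}
    (h : FactorsThrough (fun a => (f a).reverse) k) : FactorsThrough f k := by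
  obtain ⟨K, hK, g, h, hg, hh, hgh, hk⟩ := h
  refine ⟨K, hK, fun a => (g a).reverse, fun a => (h a).reverse, by simpa using hg,
    by simpa using hh, fun a => ?_, hk⟩
  have := congrArg List.reverse (hgh a)
  rw [List.reverse_reverse, List.reverse_flatMap] at this
  exact this

theorem Elementary.reverse {f : A → List B} (h : Elementary f) :
    Elementary fun a => (f a).reverse := fun k hk => h k hk.reverse

theorem card_quot_lt [Finite A] {Q : Type*} {q : A → Q} (hq : Function.Surjective q) {a b : A}
    (hab : a ≠ b) (h : q a = q b) : Nat.card Q < Nat.card A := by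
  have : Finite Q := Finite.of_surjective q hq
  cases nonempty_fintype A
  cases nonempty_fintype Q
  rw [Nat.card_eq_fintype_card, Nat.card_eq_fintype_card]
  exact Fintype.card_lt_of_surjective_not_injective q hq fun hi => hab (hi h)

/-- A link between distinct letters leaves fewer components than letters, and the graph lemma would
factor `f` through them. -/
theorem Elementary.eq_of_link [Finite A] {f : A → List B} (h : Elementary f)
    (hf : ∀ a, f a ≠ []) {a b : A} (hab : Link f a b) : a = b := by
  by_contra hne
  exact absurd (h _ (factorsThrough_card_quot_link f hf))
    (not_le.2 (card_quot_lt Quot.mk_surjective hne (Quot.sound hab)))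

/-- The extension of `f` by one letter, with image `s`. -/
def optionExt (f : A → List B) (s : List B) : Option A → List B
  | none => s
  | some a => f a

/-- The extra letter adds no component, being linked to `a`, while joining `a` to `b` loses one. So
the extended morphism, and with it `f`, would factor through fewer letters than `A` has. -/
theorem Elementary.eq_of_link_option [Finite A] {f : A → List B} (h : Elementary f)
    (hf : ∀ a, f a ≠ []) {s : List B} (hs : s ≠ []) {a b : A}
    (ha : Link (optionExt f s) none (some a)) (hb : Link (optionExt f s) none (some b)) :
    a = b := by
  by_contra hne
  obtain ⟨K, hK, g, k, hg, hk, hgk, hc⟩ := factorsThrough_card_quot_link (optionExt f s) (by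
    rintro (_ | a)
    · exact hs
    · exact hf a)
  refine absurd (h _ ⟨K, hK, fun a => g (some a), k, fun a => hg _, hk, fun a => hgk (some a), hc⟩)
    (not_le.2 (card_quot_lt (q := fun a => Quot.mk _ (some a)) ?_ hne
      ((Quot.sound ha).symm.trans (Quot.sound hb))))
  intro q
  induction q using Quot.ind with
  | mk c =>
    cases c with
    | none => exact ⟨a, (Quot.sound ha).symm⟩
    | some c => exact ⟨c, rfl⟩

theorem factor_prefix_or_prefix {x : ℤ → B} {k : ℤ} {p q : List B}
    (hp : factor x k p.length = p) (hq : factor x k q.length = q) : p <+: q ∨ q <+: p := by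
  rcases le_total p.length q.length with h | h
  · left
    obtain ⟨n, hn⟩ := Nat.exists_eq_add_of_le h
    rw [hn, factor_add, hp] at hq
    exact ⟨_, hq⟩
  · right
    obtain ⟨n, hn⟩ := Nat.exists_eq_add_of_le h
    rw [hn, factor_add, hq] at hp
    exact ⟨_, hp⟩

theorem Parse.link_of_cut_eq {f : A → List B} {y y' : ℤ → A} {c c' : ℤ → ℤ} {x : ℤ → B}
    (h : Parse f y c x) (h' : Parse f y' c' x) {i j : ℤ} (hij : c i = c' j) :
    Link f (y i) (y' j) := by
  intro N
  refine ⟨factor y (i + 1) N, factor y' (j + 1) N, by simp, by simp, ?_⟩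
  rw [← factor_succ, ← factor_succ]
  have h1 := h.word_nat i (N + 1)
  have h2 := h'.word_nat j (N + 1)
  rw [hij] at h1
  exact factor_prefix_or_prefix h1 h2

/-- From the cut onwards one parse reads whole words and the other first completes an interrupted
one; the leftover suffix plays the role of the extra letter `none`. -/
theorem Parse.link_of_straddle {f : A → List B} {y y' : ℤ → A} {c c' : ℤ → ℤ} {x : ℤ → B}
    (h : Parse f y c x) (h' : Parse f y' c' x) {i j : ℤ} {n : ℕ} (hij : c i = c' j + n)
    (hn : n < (f (y' j)).length) :
    Link (optionExt f ((f (y' j)).drop n)) none (some (y i)) := by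
  intro N
  refine ⟨(factor y' (j + 1) N).map some, (factor y (i + 1) N).map some, by simp, by simp, ?_⟩
  have h1 := h.word_nat i (N + 1)
  have h2 := h'.word_nat j (N + 1)
  rw [factor_succ] at h1 h2
  set p := (y i :: factor y (i + 1) N).flatMap f
  have e1 : (some (y i) :: (factor y (i + 1) N).map some).flatMap
      (optionExt f ((f (y' j)).drop n)) = p := by
    simp [optionExt, List.flatMap_map, p]
  have e2 : (none :: (factor y' (j + 1) N).map some).flatMap
      (optionExt f ((f (y' j)).drop n)) =
      (f (y' j)).drop n ++ (factor y' (j + 1) N).flatMap f := by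
    simp [optionExt, List.flatMap_map]
  rw [e1, e2]
  rw [List.flatMap_cons, ← List.take_append_drop n (f (y' j)), List.append_assoc] at h2
  have h3 := (factor_eq_append h2).2
  rw [List.length_take, min_eq_left hn.le, ← hij] at h3
  exact factor_prefix_or_prefix h3 h1

theorem factor_reverse (x : ℤ → B) (k : ℤ) (n : ℕ) :
    factor (fun t => x (-1 - t)) k n = (factor x (-k - n) n).reverse := by
  apply List.ext_getElem?
  intro i
  rw [getElem?_factor]
  split_ifs with h
  · rw [List.getElem?_reverse (by simpa using h), getElem?_factor, length_factor,
      if_pos (by omega)]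
    congr 2
    omega
  · simp; omega

/-- The reflection `t ↦ -1 - t` takes `[c i, c (i + 1))` to `[-c (i + 1), -c i)`. It yields leftward
statements from rightward ones. -/
theorem Parse.reverse {f : A → List B} {y : ℤ → A} {c : ℤ → ℤ} {x : ℤ → B}
    (h : Parse f y c x) :
    Parse (fun a => (f a).reverse) (fun i => y (-1 - i)) (fun i => -c (-i))
      (fun k => x (-1 - k)) := by
  have hs : ∀ i, c (-i) = c (-1 - i) + (f (y (-1 - i))).length := by
    intro i
    have := h.step (-1 - i)
    rwa [show -1 - i + 1 = -i by ring] at this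
  refine ⟨fun i => ?_, fun i => ?_⟩
  · rw [hs i, List.length_reverse, show -(i + 1) = -1 - i by ring]
    ring
  · rw [List.length_reverse, factor_reverse, hs i]
    congr 1
    rw [show - -(c (-1 - i) + ((f (y (-1 - i))).length : ℤ)) - (f (y (-1 - i))).length
      = c (-1 - i) by ring]
    exact h.word _

variable {f : A → List B} {x : ℤ → B}

/-- Letters that start at a common cut are linked, hence equal, so the next cut is common too. -/
theorem Elementary.cut_forward [Finite A] (h : Elementary f) (hf : ∀ a, f a ≠ [])
    {y y' : ℤ → A} {c c' : ℤ → ℤ} (hp : Parse f y c x) (hp' : Parse f y' c' x) {i j : ℤ}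
    (hij : c i = c' j) (n : ℕ) : c (i + n) = c' (j + n) ∧ y (i + n) = y' (j + n) := by
  induction n with
  | zero => simpa using ⟨hij, h.eq_of_link hf (hp.link_of_cut_eq hp' hij)⟩
  | succ n ih =>
    have : c (i + (n + 1 : ℕ)) = c' (j + (n + 1 : ℕ)) := by
      push_cast
      rw [← add_assoc, ← add_assoc, hp.step, hp'.step, ih.1, ih.2]
    exact ⟨this, h.eq_of_link hf (hp.link_of_cut_eq hp' this)⟩

/-- Two parses with a common cut coincide. -/
theorem Elementary.eq_of_common_cut [Finite A] (h : Elementary f) (hf : ∀ a, f a ≠ [])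
    {y y' : ℤ → A} {c c' : ℤ → ℤ} (hp : Parse f y c x) (hp' : Parse f y' c' x) {i j : ℤ}
    (hij : c i = c' j) (t : ℤ) : y' (t + (j - i)) = y t ∧ c' (t + (j - i)) = c t := by
  rcases le_or_gt i t with ht | ht
  · obtain ⟨n, rfl⟩ : ∃ n : ℕ, t = i + n := ⟨(t - i).toNat, by omega⟩
    have := h.cut_forward hf hp hp' hij n
    rw [show i + n + (j - i) = j + n by ring]
    exact ⟨this.2.symm, this.1.symm⟩
  · obtain ⟨n, rfl⟩ : ∃ n : ℕ, t = i - 1 - n := ⟨(i - 1 - t).toNat, by omega⟩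
    have hrev := fun n => h.reverse.cut_forward (by simpa using hf) hp.reverse hp'.reverse
      (i := -i) (j := -j) (by simpa using hij) n
    have h1 := (hrev (n + 1)).1
    have h2 := (hrev n).2
    simp only [neg_inj] at h1
    push_cast at h1
    rw [show -(-i + ((n : ℤ) + 1)) = i - 1 - n by ring,
      show -(-j + ((n : ℤ) + 1)) = j - 1 - n by ring] at h1
    rw [show -1 - (-i + (n : ℤ)) = i - 1 - n by ring,
      show -1 - (-j + (n : ℤ)) = j - 1 - n by ring] at h2
    rw [show i - 1 - n + (j - i) = j - 1 - n by ring]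
    exact ⟨h2.symm, h1.symm⟩

/-- At position `k` one of two parses has a cut, followed by the letter `a`, which lies in the
interior of a word `f b` of the other parse, at distance `n` from its beginning. -/
def Straddle (f : A → List B) (y : Bool → ℤ → A) (c : Bool → ℤ → ℤ) (k : ℤ) (b : A) (n : ℕ)
    (a : A) : Prop :=
  ∃ e i j, c e i = k ∧ y e i = a ∧ y (!e) j = b ∧ c (!e) j + n = k ∧ 0 < n ∧ n < (f b).length

variable {y : Bool → ℤ → A} {c : Bool → ℤ → ℤ}

/-- After reflection the letter that follows the cut is the one that used to precede it, so only its
existence is asserted. -/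
theorem Straddle.reverse (hp : ∀ e, Parse f (y e) (c e) x) {k : ℤ} {b a : A} {n : ℕ}
    (h : Straddle f y c k b n a) :
    ∃ a', Straddle (fun a => (f a).reverse) (fun e i => y e (-1 - i)) (fun e i => -c e (-i)) (-k)
      b ((f b).length - n) a' := by
  obtain ⟨e, i, j, h1, rfl, h3, h4, h5, h6⟩ := h
  refine ⟨_, e, -i, -1 - j, by simpa using h1, rfl, by simpa using h3, ?_, by omega, ?_⟩
  · have := (hp (!e)).step j
    rw [h3] at this
    simp only
    rw [show -(-1 - j) = j + 1 by ring, this]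
    omega
  · rw [List.length_reverse]; omega

/-- Of the two overlapping words, the one that ends first ends inside the other and creates the next
straddle. They cannot end together, as there is no common cut. -/
theorem Straddle.step (hp : ∀ e, Parse f (y e) (c e) x)
    (hdis : ∀ e i j, c e i ≠ c (!e) j) {k : ℤ} {b a : A} {n : ℕ}
    (h : Straddle f y c k b n a) (ha : 0 < (f a).length) :
    (∃ a', (f a).length < (f b).length - n ∧
      Straddle f y c (k + (f a).length) b (n + (f a).length) a') ∨
    (∃ a', (f b).length - n < (f a).length ∧
      Straddle f y c (k + ((f b).length - n : ℕ)) a ((f b).length - n) a') := by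
  obtain ⟨e, i, j, h1, rfl, h3, h4, h5, h6⟩ := h
  have s1 := (hp e).step i
  have s2 := (hp (!e)).step j
  rw [h3] at s2
  rcases lt_trichotomy (f (y e i)).length ((f b).length - n) with hlt | heq | hgt
  · left
    refine ⟨_, hlt, e, i + 1, j, by omega, rfl, h3, by push_cast; omega, by omega, by omega⟩
  · exact absurd (by omega) (hdis e (i + 1) (j + 1))
  · right
    refine ⟨_, hgt, !e, j + 1, i, by omega, rfl, by simp, by simp; omega, by omega, by omega⟩

/-- The suffix of `f b` behind the cut is linked to the letter that starts there, and
`eq_of_link_option` allows only one such letter. -/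
theorem Straddle.det [Finite A] (h : Elementary f) (hf : ∀ a, f a ≠ [])
    (hp : ∀ e, Parse f (y e) (c e) x) {k k' : ℤ} {b a a' : A} {n : ℕ}
    (hs : Straddle f y c k b n a) (hs' : Straddle f y c k' b n a') : a = a' := by
  have key : ∀ {k a}, Straddle f y c k b n a →
      Link (optionExt f ((f b).drop n)) none (some a) := by
    rintro k a ⟨e, i, j, h1, rfl, rfl, h4, h5, h6⟩
    exact (hp e).link_of_straddle (hp !e) (h1.trans h4.symm) h6
  have hn : n < (f b).length := by
    obtain ⟨e, i, j, h1, rfl, rfl, h4, h5, h6⟩ := hs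
    exact h6
  refine h.eq_of_link_option hf ?_ (key hs) (key hs')
  rw [ne_eq, List.drop_eq_nil_iff]
  omega

/-- The pair `(b, n)` is the state of a deterministic automaton: `det` gives the letter `a`, and
`step` gives the next state from `b`, `n` and `a`. The state therefore determines everything to its
right. -/
theorem Straddle.forward [Finite A] (h : Elementary f) (hf : ∀ a, f a ≠ [])
    (hp : ∀ e, Parse f (y e) (c e) x) (hdis : ∀ e i j, c e i ≠ c (!e) j) (t : ℕ) :
    ∀ {k k' : ℤ} {b a a' : A} {n : ℕ}, Straddle f y c k b n a → Straddle f y c k' b n a' →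
      x (k + t) = x (k' + t) := by
  induction t using Nat.strong_induction_on with
  | _ t ih =>
    intro k k' b a a' n hs hs'
    obtain rfl := hs.det h hf hp hs'
    have hpos := List.length_pos_iff.2 (hf a)
    have hcut : ∀ {k}, Straddle f y c k b n a → factor x k (f a).length = f a := by
      rintro k ⟨e, i, j, rfl, rfl, -⟩
      exact (hp e).word i
    rcases lt_or_ge t (f a).length with ht | ht
    · exact eq_of_factor_eq ((hcut hs).trans (hcut hs').symm) ht
    · have hn : n < (f b).length := by
        obtain ⟨e, i, j, h1, h2, h3, h4, h5, h6⟩ := hs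
        exact h6
      rcases hs.step hp hdis hpos with ⟨a1, hlt, h1⟩ | ⟨a1, hlt, h1⟩ <;>
      rcases hs'.step hp hdis hpos with ⟨a2, hlt', h2⟩ | ⟨a2, hlt', h2⟩
      · have := ih (t - (f a).length) (by omega) h1 h2
        rwa [add_assoc, add_assoc, ← Nat.cast_add, Nat.add_sub_cancel' ht] at this
      · omega
      · omega
      · have := ih (t - ((f b).length - n)) (by omega) h1 h2
        rwa [add_assoc, add_assoc, ← Nat.cast_add, Nat.add_sub_cancel' (by omega)] at this

/-- An elementary morphism is recognizable for aperiodic points. -/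
theorem Elementary.recognizable [Finite A] (h : Elementary f) (hf : ∀ a, f a ≠ [])
    (hx : ∀ n : ℕ, 0 < n → ∃ t, x (t + n) ≠ x t)
    {y y' : ℤ → A} {c c' : ℤ → ℤ} (hp : Parse f y c x) (hp' : Parse f y' c' x) :
    ∃ δ, ∀ i, y' (i + δ) = y i ∧ c' (i + δ) = c i := by
  by_cases hcut : ∃ i j, c i = c' j
  · obtain ⟨i, j, hij⟩ := hcut
    exact ⟨j - i, h.eq_of_common_cut hf hp hp' hij⟩
  exfalso
  -- Without a common cut every cut of `y` straddles a word of the other parse.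
  push Not at hcut
  let Y : Bool → ℤ → A := fun e => if e then y else y'
  let K : Bool → ℤ → ℤ := fun e => if e then c else c'
  have hP : ∀ e, Parse f (Y e) (K e) x := by
    rintro (_ | _)
    · exact hp'
    · exact hp
  have hdis : ∀ e i j, K e i ≠ K (!e) j := by
    rintro (_ | _) i j
    · exact (hcut j i).symm
    · exact hcut i j
  have hst : ∀ i : ℕ, ∃ b n, Straddle f Y K (c i) b n (y i) := by
    intro i
    obtain ⟨j, h1, h2⟩ := hp'.exists_index hf (c i)
    have h3 := hcut i j
    have h4 := hp'.step j
    exact ⟨y' j, (c i - c' j).toNat, true, i, j, rfl, rfl, rfl,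
      by simp only [K, Bool.not_true, Bool.false_eq_true, if_false]; omega, by omega, by omega⟩
  choose b n hbn using hst
  obtain ⟨M, hM⟩ := (Set.finite_range fun a => (f a).length).bddAbove
  have hlt : ∀ i, n i < M + 1 := by
    intro i
    obtain ⟨e, i, j, h1, h2, h3, h4, h5, h6⟩ := hbn i
    exact Nat.lt_succ_of_le (h6.le.trans (hM ⟨_, rfl⟩))
  -- There are finitely many states `(b, n)`, so one recurs. Determinism in both directions makes `c
  -- j - c i` a period of `x`.
  obtain ⟨i, j, hij, he⟩ := Finite.exists_ne_map_eq_of_infinite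
    (fun i => ((b i, ⟨n i, hlt i⟩) : A × Fin (M + 1)))
  wlog hlt' : i < j generalizing i j
  · exact this j i hij.symm he.symm (by omega)
  simp only [Prod.mk.injEq, Fin.mk.injEq] at he
  have hi := hbn i
  have hj := hbn j
  rw [← he.1, ← he.2] at hj
  have hc : c i < c j := hp.strictMono hf (by omega)
  obtain ⟨t, ht⟩ := hx (c j - c i).toNat (by omega)
  apply ht
  rw [Int.toNat_of_nonneg (by omega)]
  rcases le_or_gt (c i) t with hle | hgt
  · have := hi.forward h hf hP hdis (t - c i).toNat hj
    rw [Int.toNat_of_nonneg (by omega)] at this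
    rw [show t + (c j - c i) = c j + (t - c i) by ring, ← this]
    congr 1
    ring
  · obtain ⟨a1, h1⟩ := hi.reverse hP
    obtain ⟨a2, h2⟩ := hj.reverse hP
    have := h1.forward h.reverse (by simpa using hf) (fun e => (hP e).reverse)
      (fun e i j => by simpa using hdis e (-i) (-j)) (c i - 1 - t).toNat h2
    rw [Int.toNat_of_nonneg (by omega)] at this
    rw [show -1 - (-c i + (c i - 1 - t)) = t by ring,
      show -1 - (-c j + (c i - 1 - t)) = t + (c j - c i) by ring] at this
    exact this.symm

end Elementary

/-! ### Recognizability on aperiodic systems, by induction on the alphabet. -/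

section Recognizable

/-- `f` is recognizable on `X`: the parse of a sequence into words `f (y i)` with `y ∈ X` is
unique up to a change of indices. -/
def Recognizable {A B : Type*} (f : A → List B) (X : Set (ℤ → A)) : Prop :=
  ∀ y ∈ X, ∀ y' ∈ X, ∀ c c' x, Parse f y c x → Parse f y' c' x →
    ∃ δ, ∀ i, y' (i + δ) = y i ∧ c' (i + δ) = c i

/-- `f` maps `X` onto `X` up to shifts, and no point of `X` is periodic. -/
structure IsAperiodicSystem {A : Type*} (f : A → List A) (X : Set (ℤ → A)) : Prop where
  onto : ∀ x ∈ X, ∃ y ∈ X, ∃ c, Parse f y c x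
  image : ∀ y ∈ X, ∀ c x, Parse f y c x → x ∈ X
  aperiodic : ∀ x ∈ X, ∀ n : ℕ, 0 < n → ∃ t, x (t + n) ≠ x t

variable {A B : Type*}

/-- The parse shifted by `n` indices reads the same sequence of words, so uniqueness of images turns
it into a translation of `x`. -/
theorem Parse.periodic {f : A → List B} (hf : ∀ a, f a ≠ []) {y : ℤ → A} {c : ℤ → ℤ} {x : ℤ → B}
    (h : Parse f y c x) {n : ℕ} (hn : 0 < n) (hy : ∀ t, y (t + n) = y t) :
    ∃ l : ℕ, 0 < l ∧ ∀ t, x (t + l) = x t := by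
  have h1 := (h.reindex n).translate (c n - c 0)
  have h2 : (fun i => y (i + n)) = y := funext hy
  rw [h2] at h1
  have h3 := (h.unique hf h1 (by simp)).2
  have h4 := h.strictMono hf (show (0 : ℤ) < n by omega)
  refine ⟨(c n - c 0).toNat, by omega, fun t => ?_⟩
  rw [Int.toNat_of_nonneg (by omega)]
  exact (congrFun h3 t).symm

/-- Parses of `x` read off parses of the same sequence `m`, up to a shift, coincide. -/
theorem Parse.cut_eq_of_shift {f : A → List B} (hf : ∀ a, f a ≠ []) {m m' : ℤ → A} {e e' : ℤ → ℤ}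
    {x : ℤ → B} (h : Parse f m e x) (h' : Parse f m' e' x) {δ k : ℤ}
    (hm : ∀ i, m' (i + δ) = m i) (hk : e' (k + δ) = e k) (i : ℤ) : e' (i + δ) = e i := by
  have h1 := h'.reindex δ
  rw [show (fun i => m' (i + δ)) = m from funext hm] at h1
  have h2 := h1.reindex k
  have h3 := h.reindex k
  have h4 := (h2.unique hf h3 (by simpa using hk)).1
  have := congrFun h4 (i - k)
  simpa using this

/-- Both factors are recognizable. For `h`, apply `g` to the parsed sequence. For `g`, write points
of `X` as `h`-images of points of `Z`, which is possible since `f = h ∘ g` is onto. The two index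
changes are then composed. -/
theorem Recognizable.of_factor {A K : Type*} {f : A → List A} {g : A → List K} {h : K → List A}
    (hg : ∀ a, g a ≠ []) (hh : ∀ a, h a ≠ []) (hfg : f = fun a => (g a).flatMap h)
    {X : Set (ℤ → A)} {Z : Set (ℤ → K)} (hZ : ∀ z, z ∈ Z ↔ ∃ x ∈ X, ∃ c, Parse g x c z)
    (hX : IsAperiodicSystem f X) (hr : Recognizable (fun k => (h k).flatMap g) Z) :
    Recognizable f X := by
  have rh : Recognizable h Z := by
    intro z hz z' hz' c c' x hp hp'
    obtain ⟨e, w, -, hw⟩ := Parse.exists_image hg x 0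
    obtain ⟨δ, hδ⟩ := hr z hz z' hz' _ _ w (hw.comp hp) (hw.comp hp')
    exact ⟨δ, fun i => ⟨(hδ i).1, (hw.strictMono hg).injective (hδ i).2⟩⟩
  have rg : Recognizable g X := by
    intro y hy y' hy' c c' z hp hp'
    have key : ∀ y ∈ X, ∃ v ∈ Z, ∃ d, Parse h v d y := by
      intro y hy
      obtain ⟨u, hu, b, hb⟩ := hX.onto y hy
      rw [hfg] at hb
      obtain ⟨e, v, d, h1, h2, -⟩ := hb.decomp hg hh
      exact ⟨v, (hZ v).2 ⟨u, hu, e, h1⟩, d, h2⟩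
    obtain ⟨v, hv, d, hd⟩ := key y hy
    obtain ⟨v', hv', d', hd'⟩ := key y' hy'
    obtain ⟨δ, hδ⟩ := hr v hv v' hv' _ _ z (hp.comp hd) (hp'.comp hd')
    have h1 := (hd'.reindex δ).translate (d' δ - d 0)
    rw [show (fun i => v' (i + δ)) = v from funext fun i => (hδ i).1] at h1
    obtain ⟨h2, h3⟩ := hd.unique hh h1 (by simp)
    have hyy : ∀ i, y' (i + (d' δ - d 0)) = y i := fun i => (congrFun h3 i).symm
    refine ⟨d' δ - d 0, fun i => ⟨hyy i, ?_⟩⟩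
    -- Recognizability of `g ∘ h` matches the cuts at the images of `h`-words only; one matching cut
    -- suffices for all.
    refine hp.cut_eq_of_shift hg hp' hyy (k := d 0) ?_ i
    have := (hδ 0).2
    rw [zero_add] at this
    rw [← this]
    congr 1
    ring
  intro y hy y' hy' c c' x hp hp'
  rw [hfg] at hp hp'
  obtain ⟨d, m, e, h1, h2, h3⟩ := hp.decomp hg hh
  obtain ⟨d', m', e', h1', h2', h3'⟩ := hp'.decomp hg hh
  obtain ⟨δ, hδ⟩ := rh m ((hZ m).2 ⟨y, hy, d, h1⟩) m' ((hZ m').2 ⟨y', hy', d', h1'⟩) _ _ x h2 h2'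
  have h4 := h1'.translate δ
  rw [show (fun i => m' (i + δ)) = m from funext fun i => (hδ i).1] at h4
  obtain ⟨ε, hε⟩ := rg y hy y' hy' _ _ m h1 h4
  refine ⟨ε, fun i => ⟨(hε i).1, ?_⟩⟩
  rw [h3, h3', ← (hδ (d i)).2, ← (hε i).2, sub_add_cancel]

/-- If `z = g(x)` then `h(z) = f(x)` is again in `X` and inherits every period of `z`, so `z` has
none. -/
theorem IsAperiodicSystem.of_factor {A K : Type*} {f : A → List A} {g : A → List K}
    {h : K → List A}
    (hg : ∀ a, g a ≠ []) (hh : ∀ a, h a ≠ []) (hfg : f = fun a => (g a).flatMap h)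
    {X : Set (ℤ → A)} (hX : IsAperiodicSystem f X) :
    IsAperiodicSystem (fun k => (h k).flatMap g) {z | ∃ x ∈ X, ∃ c, Parse g x c z} where
  onto := by
    rintro z ⟨x, hx, c, hc⟩
    obtain ⟨y, hy, b, hb⟩ := hX.onto x hx
    rw [hfg] at hb
    obtain ⟨d, m, e, h1, h2, -⟩ := hb.decomp hg hh
    exact ⟨m, ⟨y, hy, d, h1⟩, _, hc.comp h2⟩
  image := by
    rintro z ⟨x, hx, c, hc⟩ b w hw
    obtain ⟨d, m, e, h1, h2, -⟩ := hw.decomp hh hg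
    have h3 := h1.comp hc
    rw [← hfg] at h3
    exact ⟨m, hX.image x hx _ _ h3, e, h2⟩
  aperiodic := by
    rintro z ⟨x, hx, c, hc⟩ n hn
    by_contra! hper
    obtain ⟨d, w, -, hw⟩ := Parse.exists_image hh z 0
    have h3 := hw.comp hc
    rw [← hfg] at h3
    obtain ⟨l, hl, hwl⟩ := hw.periodic hh hn hper
    obtain ⟨t, ht⟩ := hX.aperiodic w (hX.image x hx _ _ h3) l hl
    exact ht (hwl t)

/-- A nonerasing morphism of an aperiodic system onto itself is recognizable. -/
theorem IsAperiodicSystem.recognizable {A : Type u} [Finite A] {f : A → List A}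
    (hf : ∀ a, f a ≠ []) {X : Set (ℤ → A)} (hX : IsAperiodicSystem f X) : Recognizable f X := by
  obtain ⟨n, hn⟩ : ∃ n, Nat.card A ≤ n := ⟨_, le_rfl⟩
  induction n generalizing A with
  | zero =>
    intro y _
    rw [Nat.le_zero, Finite.card_eq_zero_iff] at hn
    exact (hn.false (y 0)).elim
  | succ n ih =>
    by_cases he : Elementary f
    · intro y hy y' hy' c c' x hp hp'
      exact he.recognizable hf (hX.aperiodic x (hX.image y hy c x hp)) hp hp'
    · simp only [Elementary, not_forall, not_le] at he
      obtain ⟨k, ⟨K, hK, g, h, hg, hh, hgh, hk⟩, hlt⟩ := he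
      exact Recognizable.of_factor hg hh (funext hgh) (fun _ => Iff.rfl) hX
        (ih (fun a => flatMap_ne_nil hg (hh a)) (hX.of_factor hg hh (funext hgh)) (by omega))

end Recognizable

/-! ### Powers of a substitution and their language. -/

section Power

variable {A : Type*} {σ : A → List A}

theorem infix_flatMap {B : Type*} {f : A → List B} {u v : List A} (h : u <:+: v) :
    u.flatMap f <:+: v.flatMap f := by
  obtain ⟨s, t, rfl⟩ := h
  exact ⟨s.flatMap f, t.flatMap f, by simp⟩

theorem iterate_onWord (σ : A → List A) (n : ℕ) (u : List A) :
    (onWord σ)^[n] u = u.flatMap (power σ n) := by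
  induction u with
  | nil => exact Function.iterate_fixed rfl n
  | cons a u ih =>
    have happ : ∀ n (u v : List A),
        (onWord σ)^[n] (u ++ v) = (onWord σ)^[n] u ++ (onWord σ)^[n] v := by
      intro n
      induction n with
      | zero => simp
      | succ n ih =>
        intro u v
        rw [Function.iterate_succ_apply, Function.iterate_succ_apply, Function.iterate_succ_apply,
          ← ih]
        simp [onWord]
    rw [List.flatMap_cons, ← ih, ← List.singleton_append, happ]
    rfl

@[simp] theorem power_zero (σ : A → List A) (a : A) : power σ 0 a = [a] := rfl

theorem power_add (σ : A → List A) (m n : ℕ) (a : A) :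
    power σ (m + n) a = (power σ m a).flatMap (power σ n) := by
  rw [← iterate_onWord, power, add_comm, Function.iterate_add_apply, power]

@[simp] theorem power_one (σ : A → List A) : power σ 1 = σ := by
  funext a
  simp [power, onWord]

theorem power_succ (σ : A → List A) (n : ℕ) (a : A) :
    power σ (n + 1) a = (power σ n a).flatMap σ := by
  rw [power_add, power_one]

theorem power_power (σ : A → List A) (p k : ℕ) : power (power σ p) k = power σ (p * k) := by
  funext a
  induction k with
  | zero => rfl
  | succ k ih => rw [power_succ, ih, Nat.mul_succ, power_add]

theorem power_ne_nil (hσ : ∀ a, σ a ≠ []) (n : ℕ) (a : A) : power σ n a ≠ [] := by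
  induction n with
  | zero => simp
  | succ n ih => rw [power_succ]; exact flatMap_ne_nil hσ ih

theorem language_of_infix {u v : List A} (h : u <:+: v) (hv : v ∈ language σ) :
    u ∈ language σ := by
  obtain ⟨a, n, hn, hv⟩ := hv
  exact ⟨a, n, hn, h.trans hv⟩

theorem flatMap_mem_language {u : List A} (h : u ∈ language σ) (p : ℕ) :
    u.flatMap (power σ p) ∈ language σ := by
  obtain ⟨a, n, hn, hu⟩ := h
  exact ⟨a, n + p, by omega, by rw [power_add]; exact infix_flatMap hu⟩

end Power

/-! ### Limits of parses along ultrafilters. -/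

section Limit

variable {A : Type*} {B : Type*}

theorem eventually_eq_of_finite {ι : Type*} (U : Ultrafilter ι) {s : Set A} (hs : s.Finite)
    (g : ι → A) (hg : ∀ᶠ n in U, g n ∈ s) : ∃ a, ∀ᶠ n in U, g n = a := by
  have h1 : (⋃ a ∈ s, g ⁻¹' {a}) ∈ U := by
    refine Filter.mem_of_superset hg fun n hn => ?_
    simpa using hn
  obtain ⟨a, -, ha⟩ := (Ultrafilter.finite_biUnion_mem_iff hs).1 h1
  exact ⟨a, ha⟩

theorem eventually_factor {ι : Type*} {l : Filter ι} {X : ι → ℤ → A} {x : ℤ → A}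
    (h : ∀ k, ∀ᶠ n in l, X n k = x k) (k : ℤ) (m : ℕ) :
    ∀ᶠ n in l, factor (X n) k m = factor x k m := by
  have : ∀ᶠ n in l, ∀ i ∈ Finset.range m, X n (k + i) = x (k + i) :=
    (Filter.eventually_all_finset _).2 fun i _ => h _
  filter_upwards [this] with n hn
  exact factor_congr fun i hi => hn i (Finset.mem_range.2 hi)

/-- A parse has its zeroth word straddling the origin. -/
def Centered (c : ℤ → ℤ) : Prop := c 0 ≤ 0 ∧ 0 < c 1

theorem Parse.exists_centered {f : A → List B} (hf : ∀ a, f a ≠ []) {y : ℤ → A} {c : ℤ → ℤ}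
    {x : ℤ → B} (h : Parse f y c x) : ∃ i, Centered fun j => c (j + i) := by
  obtain ⟨i, hi, hi'⟩ := h.exists_index hf 0
  exact ⟨i, by simpa using hi, by simpa [add_comm] using hi'⟩

/-- Limits of parses along an ultrafilter. -/
theorem Parse.exists_limit [Finite A] {ι : Type*} (U : Ultrafilter ι) {f : A → List B}
    {Y : ι → ℤ → A} {C : ι → ℤ → ℤ} {X : ι → ℤ → B} {x : ℤ → B}
    (hp : ∀ᶠ n in U, Parse f (Y n) (C n) (X n)) (hC : ∀ᶠ n in U, Centered (C n))
    (hx : ∀ k, ∀ᶠ n in U, X n k = x k) :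
    ∃ y c, Parse f y c x ∧ Centered c ∧ (∀ i, ∀ᶠ n in U, Y n i = y i) ∧
      ∀ i, ∀ᶠ n in U, C n i = c i := by
  have hy : ∀ i, ∃ a, ∀ᶠ n in U, Y n i = a := fun i =>
    eventually_eq_of_finite U Set.finite_univ _ (by simp)
  choose y hy using hy
  obtain ⟨M, hM⟩ := (Set.finite_range fun a => (f a).length).bddAbove
  have hc : ∀ i, ∃ k, ∀ᶠ n in U, C n i = k := by
    intro i
    induction i using Int.induction_on with
    | zero =>
      -- Centring and the bound `M` on word lengths confine the zeroth cut to finitely many values;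
      -- the other cuts follow from it and the letters.
      refine eventually_eq_of_finite U (Set.finite_Icc (-M : ℤ) 0) _ ?_
      filter_upwards [hp, hC] with n hn hn'
      have h1 := hn.step 0
      have h2 : (f (Y n 0)).length ≤ M := hM ⟨_, rfl⟩
      have h3 := hn'.1
      have h4 := hn'.2
      rw [zero_add] at h1
      exact ⟨by omega, h3⟩
    | succ i ih =>
      obtain ⟨k, hk⟩ := ih
      refine ⟨k + (f (y i)).length, ?_⟩
      filter_upwards [hp, hk, hy i] with n h1 h2 h3
      rw [h1.step, h2, h3]
    | pred i ih =>
      obtain ⟨k, hk⟩ := ih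
      refine ⟨k - (f (y (-i - 1))).length, ?_⟩
      filter_upwards [hp, hk, hy (-i - 1)] with n h1 h2 h3
      have := h1.step (-i - 1)
      rw [sub_add_cancel, h2, h3] at this
      linarith
  choose c hc using hc
  refine ⟨y, c, ⟨fun i => ?_, fun i => ?_⟩, ?_, hy, hc⟩
  · obtain ⟨n, h1, h2, h3, h4⟩ := (hp.and ((hc i).and ((hc (i + 1)).and (hy i)))).exists
    rw [← h2, ← h3, ← h4, h1.step]
  · obtain ⟨n, h1, h2, h3, h4⟩ := (hp.and ((hc i).and ((hy i).and
      (eventually_factor hx (c i) (f (y i)).length)))).exists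
    have := h1.word i
    rw [h2, h3] at this
    rw [← h4, this]
  · obtain ⟨n, h1, h2, h3⟩ := (hC.and ((hc 0).and (hc 1))).exists
    exact ⟨h2 ▸ h1.1, h3 ▸ h1.2⟩

end Limit

/-! ### The substitution space: desubstitution and recognizability. -/

section Space

variable {A : Type*} {σ : A → List A}

theorem mem_space_iff {x : ℤ → A} : x ∈ space σ ↔ ∀ k n, factor x k n ∈ language σ := by
  constructor
  · intro h k n
    refine language_of_infix (factor_infix x ?_ ?_) (h (k.natAbs + n)) <;> omega
  · exact fun h n => h _ _

theorem translate_mem_space {x : ℤ → A} (h : x ∈ space σ) (k : ℤ) :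
    (fun i => x (i + k)) ∈ space σ := by
  rw [mem_space_iff] at h ⊢
  intro t n
  rw [factor_translate]
  exact h _ _

theorem mem_space_of_limit {ι : Type*} {l : Filter ι} [l.NeBot] {X : ι → ℤ → A} {x : ℤ → A}
    (hX : ∀ᶠ n in l, X n ∈ space σ) (h : ∀ k, ∀ᶠ n in l, X n k = x k) : x ∈ space σ := by
  intro n
  obtain ⟨i, h1, h2⟩ := (hX.and (eventually_factor h (-(n : ℤ)) (2 * n + 1))).exists
  rw [← h2]
  exact h1 n

theorem image_mem_space (hσ : ∀ a, σ a ≠ []) {p : ℕ} {x y : ℤ → A} {c : ℤ → ℤ}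
    (hy : y ∈ space σ) (h : Parse (power σ p) y c x) : x ∈ space σ := by
  rw [mem_space_iff] at hy ⊢
  intro k n
  obtain ⟨i, hi, hi'⟩ := h.exists_index (power_ne_nil hσ p) k
  have h1 := h.add_le (power_ne_nil hσ p) (i + 1) n
  have h2 := h.step_nat i (n + 1)
  refine language_of_infix ?_ (flatMap_mem_language (hy i (n + 1)) p)
  rw [← h.word_nat]
  refine factor_infix x hi ?_
  rw [← h2]
  push_cast
  rw [show i + ((n : ℤ) + 1) = i + 1 + n by ring]
  omega

variable (hσ : ∀ a, σ a ≠ []) (hlang : ∀ k : ℕ, 1 ≤ k → language σ = language (power σ k))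
  (hlet : ∀ a : A, [a] ∈ spaceLanguage σ)
include hσ hlet

theorem exists_factor_eq_power (n : ℕ) (a : A) :
    ∃ x ∈ space σ, ∃ k, factor x k (power σ n a).length = power σ n a := by
  obtain ⟨x, hx, k, hk⟩ := hlet a
  obtain ⟨c, z, -, hz⟩ := Parse.exists_image (power_ne_nil hσ n) x 0
  have : x k = a := by simpa using hk
  exact ⟨z, image_mem_space hσ hx hz, c k, by simpa [this] using hz.word k⟩

include hlang

/-- Since `L(σ) = L(σᵖ)`, each window of `x` lies in a word `σᵖ(v)` with `v` occurring in a point of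
`X_σ`. A limit of the resulting centred parses is a parse of `x`. -/
theorem exists_preimage {p : ℕ} (hp : 1 ≤ p) [Finite A] {x : ℤ → A} (hx : x ∈ space σ) :
    ∃ y ∈ space σ, ∃ c, Parse (power σ p) y c x := by
  have key : ∀ n : ℕ, ∃ y ∈ space σ, ∃ c z, Parse (power σ p) y c z ∧ Centered c ∧
      factor z (-(n : ℤ)) (2 * n + 1) = factor x (-(n : ℤ)) (2 * n + 1) := by
    intro n
    have h := hx n
    rw [hlang p hp] at h
    obtain ⟨a, m, hm, hu⟩ := h
    obtain ⟨m, rfl⟩ := Nat.exists_eq_add_of_le' hm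
    rw [power_succ, power_power] at hu
    obtain ⟨y, hy, k, hk⟩ := exists_factor_eq_power hσ hlet (p * m) a
    obtain ⟨c, z, -, hz⟩ := Parse.exists_image (power_ne_nil hσ p) y 0
    rw [← hk, ← hz.word_nat] at hu
    obtain ⟨t, -, -, ht⟩ := exists_factor_of_infix hu
    rw [length_factor] at ht
    have h1 := hz.translate (t + n)
    obtain ⟨i, hi⟩ := h1.exists_centered (power_ne_nil hσ p)
    refine ⟨_, translate_mem_space hy i, _, _, h1.reindex i, hi, ?_⟩
    rw [factor_translate]
    simpa using ht
  choose Y hY C Z hP hC hZ using key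
  obtain ⟨y, c, h1, -, h2, -⟩ := Parse.exists_limit (Filter.hyperfilter ℕ)
    (Filter.Eventually.of_forall hP) (Filter.Eventually.of_forall hC) (x := x) (by
      intro k
      refine Nat.hyperfilter_le_atTop ?_
      filter_upwards [Filter.eventually_ge_atTop k.natAbs] with n hn
      have := eq_of_factor_eq (hZ n) (i := (k + n).toNat) (by omega)
      rwa [show -(n : ℤ) + (k + n).toNat = k by omega] at this)
  exact ⟨y, mem_space_of_limit (Filter.Eventually.of_forall hY) h2, c, h1⟩

theorem isAperiodicSystem_space (hap : IsAperiodic σ) {p : ℕ} (hp : 1 ≤ p) [Finite A] :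
    IsAperiodicSystem (power σ p) (space σ) where
  onto _ hx := exists_preimage hσ hlang hlet hp hx
  image _ hy _ _ h := image_mem_space hσ hy h
  aperiodic x hx n hn := by
    by_contra! h
    have hs : ∀ n : ℕ, shift^[n] x = fun k => x (k + n) := by
      intro n
      induction n with
      | zero => simp
      | succ n ih =>
        rw [Function.iterate_succ_apply', ih]
        funext k
        simp only [shift]
        congr 1
        push_cast
        ring
    exact hap x hx n hn (by rw [hs]; exact funext h)

theorem recognizable_space (hap : IsAperiodic σ) {p : ℕ} (hp : 1 ≤ p) [Finite A] :
    Recognizable (power σ p) (space σ) :=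
  (isAperiodicSystem_space hσ hlang hlet hap hp).recognizable (power_ne_nil hσ p)

end Space

/-! ### Enumerating cut sets by `ℤ`. -/

section Enumeration

theorem exists_strictMono_range_eq {S : Set ℤ} (hup : ∀ k, ∃ t ∈ S, k < t)
    (hdown : ∀ k, ∃ t ∈ S, t < k) : ∃ c : ℤ → ℤ, StrictMono c ∧ Set.range c = S := by
  classical
  have : Nonempty S := let ⟨t, ht, _⟩ := hup 0; ⟨⟨t, ht⟩⟩
  have : NoMaxOrder S := ⟨fun a => let ⟨t, ht, h⟩ := hup a; ⟨⟨t, ht⟩, h⟩⟩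
  have : NoMinOrder S := ⟨fun a => let ⟨t, ht, h⟩ := hdown a; ⟨⟨t, ht⟩, h⟩⟩
  let : SuccOrder S := LinearLocallyFiniteOrder.succOrder S
  let : PredOrder S := LinearLocallyFiniteOrder.predOrder S
  let e : S ≃o ℤ := orderIsoIntOfLinearSuccPredArch
  refine ⟨fun i => (e.symm i : ℤ), fun i j h => e.symm.strictMono h, ?_⟩
  ext t
  constructor
  · rintro ⟨i, rfl⟩
    exact (e.symm i).2
  · exact fun ht => ⟨e ⟨t, ht⟩, by simp⟩

theorem StrictMono.eq_of_range_subset {c c' : ℤ → ℤ} (hc : StrictMono c) (hc' : StrictMono c')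
    (h : ∀ i, ∃ j, c i = c' j) (h' : ∀ i, ∃ j, c' i = c j) (h0 : c 0 = c' 0) : c = c' := by
  have up : ∀ {c c' : ℤ → ℤ}, StrictMono c → StrictMono c' → (∀ i, ∃ j, c i = c' j) →
      ∀ {i}, c i = c' i → c' (i + 1) ≤ c (i + 1) := by
    intro c c' hc hc' h i hi
    obtain ⟨j, hj⟩ := h (i + 1)
    have : i < j := hc'.lt_iff_lt.1 (by rw [← hi, ← hj]; exact hc (by omega))
    rw [hj]
    exact hc'.monotone (by omega)
  have down : ∀ {c c' : ℤ → ℤ}, StrictMono c → StrictMono c' → (∀ i, ∃ j, c i = c' j) →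
      ∀ {i}, c i = c' i → c (i - 1) ≤ c' (i - 1) := by
    intro c c' hc hc' h i hi
    obtain ⟨j, hj⟩ := h (i - 1)
    have : j < i := hc'.lt_iff_lt.1 (by rw [← hi, ← hj]; exact hc (by omega))
    rw [hj]
    exact hc'.monotone (by omega)
  funext i
  induction i using Int.induction_on with
  | zero => exact h0
  | succ i ih => exact le_antisymm (up hc' hc h' ih.symm) (up hc hc' h ih)
  | pred i ih => exact le_antisymm (down hc hc' h ih) (down hc' hc h' ih.symm)

end Enumeration

/-! ### Return words and the parse of a point into them. -/

section ReturnWords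

variable {A : Type u} {σ : A → List A} {m p : ℕ} {w : Fin m → ℤ → A}

/-- An occurrence of some `r_j . l_j` in `x`, with `l_j` at coordinate `k`. -/
def IsCut (w : Fin m → ℤ → A) (x : ℤ → A) (k : ℤ) : Prop :=
  ∃ j, x (k - 1) = w j (-1) ∧ x k = w j 0

/-- The facts about a substitution and its base points on which the construction rests. -/
structure BaseData (σ : A → List A) (p : ℕ) (w : Fin m → ℤ → A) : Prop where
  ne_nil : ∀ a, σ a ≠ []
  recog : Recognizable (power σ p) (space σ)
  preimage : ∀ x ∈ space σ, ∃ y ∈ space σ, ∃ c, Parse (power σ p) y c x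
  inj_left : ∀ i j, w i (-1) = w j (-1) → i = j
  inj_right : ∀ i j, w i 0 = w j 0 → i = j
  image_right : ∀ i, ∃ v, v ≠ [] ∧ power σ p (w i 0) = w i 0 :: v
  image_left : ∀ i, ∃ v, v ≠ [] ∧ power σ p (w i (-1)) = v ++ [w i (-1)]
  gaps : ∃ L : ℕ, ∀ x ∈ space σ, ∀ k : ℤ, ∃ t, k < t ∧ t ≤ k + L ∧ IsCut w x t

theorem pair_infix_factor {x : ℤ → A} {a b : A} {k : ℤ} {n : ℕ} :
    [a, b] <:+: factor x k n ↔ ∃ t, k < t ∧ t < k + n ∧ x (t - 1) = a ∧ x t = b := by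
  constructor
  · intro h
    obtain ⟨t, h1, h2, h3⟩ := exists_factor_of_infix h
    simp only [List.length_cons, List.length_nil] at h2 h3
    simp only [factor_succ, factor_zero, List.cons.injEq] at h3
    exact ⟨t + 1, by omega, by push_cast at h2; omega, by simpa using h3.1, h3.2.1⟩
  · rintro ⟨t, h1, h2, rfl, rfl⟩
    have : [x (t - 1), x t] = factor x (t - 1) 2 := by simp [factor_succ]
    rw [this]
    exact factor_infix x (by omega) (by push_cast; omega)

theorem getLast?_factor (x : ℤ → A) (k : ℤ) {n : ℕ} (hn : 0 < n) :
    (factor x k n).getLast? = some (x (k + n - 1)) := by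
  obtain ⟨n, rfl⟩ := Nat.exists_eq_succ_of_ne_zero hn.ne'
  rw [Nat.succ_eq_add_one, factor_succ']
  simp only [List.getLast?_append, List.getLast?_singleton, Option.some_or]
  congr 2
  push_cast
  ring

theorem head?_factor (x : ℤ → A) (k : ℤ) {n : ℕ} (hn : 0 < n) :
    (factor x k n).head? = some (x k) := by
  obtain ⟨n, rfl⟩ := Nat.exists_eq_succ_of_ne_zero hn.ne'
  rw [Nat.succ_eq_add_one, factor_succ]
  rfl

theorem returnWords_ne_nil (u : returnWords σ w) : u.1 ≠ [] := by
  obtain ⟨-, ⟨i, j, -, h, -⟩, -⟩ := u.2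
  intro h0
  simp [h0] at h

/-- `x` is parsed into return words, all cuts being occurrences of words `r_j . l_j`. -/
structure ReturnParse (d : ℤ → returnWords σ w) (c : ℤ → ℤ) (x : ℤ → A) : Prop where
  parse : Parse Subtype.val d c x
  cut : ∀ i, IsCut w x (c i)

variable {d d' : ℤ → returnWords σ w} {c c' : ℤ → ℤ} {x : ℤ → A}

theorem Parse.strictMono_return (h : Parse Subtype.val d c x) : StrictMono c :=
  h.strictMono returnWords_ne_nil

namespace ReturnParse

theorem strictMono (h : ReturnParse d c x) : StrictMono c := h.parse.strictMono_return

theorem exists_index_of_cut (h : ReturnParse d c x) {k : ℤ} (hk : IsCut w x k) :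
    ∃ i, k = c i := by
  obtain ⟨i, h1, h2⟩ := h.parse.exists_index returnWords_ne_nil k
  refine ⟨i, ?_⟩
  by_contra hne
  obtain ⟨j, h3, h4⟩ := hk
  refine (d i).2.2.2 j ?_
  rw [← h.parse.word i, pair_infix_factor]
  have := h.parse.step i
  exact ⟨k, by omega, by omega, h3, h4⟩

theorem reindex (h : ReturnParse d c x) (k : ℤ) :
    ReturnParse (fun i => d (i + k)) (fun i => c (i + k)) x :=
  ⟨h.parse.reindex k, fun _ => h.cut _⟩

theorem translate (h : ReturnParse d c x) (k : ℤ) :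
    ReturnParse d (fun i => c i - k) (fun i => x (i + k)) :=
  ⟨h.parse.translate k, fun i => by
    obtain ⟨j, h1, h2⟩ := h.cut i
    exact ⟨j, by rw [← h1]; simp only; congr 1; ring, by rw [← h2]; simp only; congr 1; ring⟩⟩

theorem unique_aux (h : ReturnParse d c x) (h' : ReturnParse d' c' x) (h0 : c 0 = c' 0) :
    d = d' ∧ c = c' := by
  have hc : c = c' := StrictMono.eq_of_range_subset h.strictMono h'.strictMono
    (fun i => h'.exists_index_of_cut (h.cut i)) (fun i => h.exists_index_of_cut (h'.cut i)) h0
  refine ⟨funext fun i => Subtype.ext ?_, hc⟩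
  have h1 := h.parse.step i
  have h2 := h'.parse.step i
  rw [← hc] at h2
  rw [← h.parse.word i, ← h'.parse.word i, ← hc]
  congr 1
  omega

theorem unique (h : ReturnParse d c x) (h' : ReturnParse d' c' x) :
    ∃ δ, ∀ i, d' (i + δ) = d i ∧ c' (i + δ) = c i := by
  obtain ⟨δ, hδ⟩ := h'.exists_index_of_cut (h.cut 0)
  obtain ⟨h1, h2⟩ := h.unique_aux (h'.reindex δ) (by simpa using hδ)
  exact ⟨δ, fun i => ⟨(congrFun h1 i).symm, (congrFun h2 i).symm⟩⟩

theorem junction (h : ReturnParse d c x) (i : ℤ) :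
    ∃ j, (d i).1.getLast? = some (w j (-1)) ∧ (d (i + 1)).1.head? = some (w j 0) := by
  obtain ⟨j, h1, h2⟩ := h.cut (i + 1)
  refine ⟨j, ?_, ?_⟩
  · rw [← h.parse.word i, getLast?_factor _ _ (List.length_pos_iff.2 (returnWords_ne_nil _)),
      ← h.parse.step, h1]
  · rw [← h.parse.word, head?_factor _ _ (List.length_pos_iff.2 (returnWords_ne_nil _)), h2]

end ReturnParse

/-- The sequences of return words of the points of `X_σ`. -/
def returnSpace (σ : A → List A) (w : Fin m → ℤ → A) : Set (ℤ → returnWords σ w) :=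
  {d | ∃ x ∈ space σ, ∃ c, ReturnParse d c x}

/-- The concatenation of a sequence of return words is unique up to translation, so any parse
inherits the cuts of the one that witnesses `hd`. -/
theorem returnParse_of_parse (hd : d ∈ returnSpace σ w) (h : Parse Subtype.val d c x) :
    x ∈ space σ ∧ ReturnParse d c x := by
  obtain ⟨x', hx', c', h'⟩ := hd
  have h1 := h'.translate (c' 0 - c 0)
  obtain ⟨h2, h3⟩ := h.unique returnWords_ne_nil h1.parse (by simp)
  rw [h2, h3]
  exact ⟨translate_mem_space hx' _, h1⟩

theorem reindex_mem_returnSpace (hd : d ∈ returnSpace σ w) (k : ℤ) :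
    (fun i => d (i + k)) ∈ returnSpace σ w := by
  obtain ⟨x, hx, c, h⟩ := hd
  exact ⟨x, hx, _, h.reindex k⟩

namespace BaseData

variable (H : BaseData σ p w)
include H

/-- Bounded gaps make the set of cuts unbounded in both directions; the words between consecutive
cuts contain no further `r_k l_k` and are thus return words. -/
theorem exists_returnParse (hx : x ∈ space σ) :
    ∃ d : ℤ → returnWords σ w, ∃ c, ReturnParse d c x := by
  obtain ⟨L, hL⟩ := H.gaps
  obtain ⟨c, hc, hr⟩ := exists_strictMono_range_eq (S := {k | IsCut w x k})
    (fun k => let ⟨t, h1, _, h3⟩ := hL x hx k; ⟨t, h3, h1⟩)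
    (fun k => let ⟨t, _, h2, h3⟩ := hL x hx (k - L - 1); ⟨t, h3, by omega⟩)
  have hcut : ∀ i, IsCut w x (c i) := fun i => by
    have : c i ∈ Set.range c := ⟨i, rfl⟩
    rwa [hr] at this
  have hlt : ∀ i, c i < c (i + 1) := fun i => hc (by omega)
  have hmem : ∀ i, factor x (c i) (c (i + 1) - c i).toNat ∈ returnWords σ w := by
    intro i
    obtain ⟨j, hj1, hj2⟩ := hcut i
    obtain ⟨j', hj1', hj2'⟩ := hcut (i + 1)
    have h1 := hlt i
    refine ⟨⟨x, hx, c i, by rw [length_factor]⟩, ⟨j, j', ⟨x, hx, c i - 1, ?_⟩, ?_, ?_⟩, ?_⟩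
    · simp only [List.length_append, length_factor, List.length_cons, List.length_nil]
      rw [factor_add, factor_add]
      simp only [zero_add, factor_one, Nat.cast_one, Nat.cast_add]
      rw [hj1, sub_add_cancel, show c i - 1 + (1 + ((c (i + 1) - c i).toNat : ℤ)) = c (i + 1) by
        omega, hj2']
    · rw [head?_factor _ _ (by omega), hj2]
    · rw [getLast?_factor _ _ (by omega), ← hj1']
      congr 2
      omega
    · intro k hk
      obtain ⟨t, h2, h3, h4⟩ := pair_infix_factor.1 hk
      have : t ∈ Set.range c := by rw [hr]; exact ⟨k, h4⟩
      obtain ⟨i', rfl⟩ := this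
      have h5 := hc.lt_iff_lt.1 h2
      have h6 := hc.lt_iff_lt.1 (show c i' < c (i + 1) by omega)
      omega
  refine ⟨fun i => ⟨_, hmem i⟩, c, ⟨fun i => ?_, fun i => ?_⟩, hcut⟩
  · have := hlt i
    simp only [length_factor]
    omega
  · simp

theorem finite_returnWords [Finite A] : (returnWords σ w).Finite := by
  obtain ⟨L, hL⟩ := H.gaps
  refine (List.finite_length_le A L).subset ?_
  rintro u ⟨⟨x, hx, k, hk⟩, -, hu⟩
  by_contra hlt
  simp only [Set.mem_ofPred_eq, not_le] at hlt
  obtain ⟨t, h1, h2, j, h3⟩ := hL x hx k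
  refine hu j ?_
  rw [← hk, pair_infix_factor]
  exact ⟨t, h1, by omega, h3⟩

/-- In a point containing `r_i u l_j` both ends of `u` are cuts, and no cut lies between them since
`u` contains no `r_k l_k`. -/
theorem exists_returnParse_of_returnWord (u : returnWords σ w) :
    ∃ x ∈ space σ, ∃ d : ℤ → returnWords σ w, ∃ c, ReturnParse d c x ∧ d 0 = u := by
  obtain ⟨-, ⟨i, j, ⟨x, hx, k, hk⟩, hi, hj⟩, hu⟩ := u.2
  obtain ⟨d, c, h⟩ := H.exists_returnParse hx
  have hpos := List.length_pos_iff.2 (returnWords_ne_nil u)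
  obtain ⟨h1, h2⟩ := factor_eq_append hk
  obtain ⟨h3, h4⟩ := factor_eq_append h1
  simp only [List.length_singleton, factor_one, List.length_append, List.cons.injEq, and_true]
    at h2 h3 h4
  have hk1 : IsCut w x (k + 1) := by
    refine ⟨i, by rw [add_sub_cancel_right, h3], ?_⟩
    rw [← h4, head?_factor _ _ hpos] at hi
    simpa using hi
  have hk2 : IsCut w x (k + 1 + u.1.length) := by
    refine ⟨j, ?_, by rw [← h2]; congr 1; push_cast; ring⟩
    rw [← h4, getLast?_factor _ _ hpos] at hj
    simpa using hj
  obtain ⟨a, ha⟩ := h.exists_index_of_cut hk1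
  obtain ⟨b, hb⟩ := h.exists_index_of_cut hk2
  have hab : b = a + 1 := by
    have h5 : a < b := h.strictMono.lt_iff_lt.1 (by omega)
    by_contra hne
    have h6 : c a < c (a + 1) := h.strictMono (by omega)
    have h7 : c (a + 1) < c b := h.strictMono (by omega)
    obtain ⟨t, ht⟩ := h.cut (a + 1)
    refine hu t ?_
    rw [← h4, pair_infix_factor]
    refine ⟨c (a + 1), ?_, ?_, ht⟩
    · push_cast; omega
    · push_cast; omega
  refine ⟨x, hx, _, _, h.reindex a, Subtype.ext ?_⟩
  simp only [zero_add]
  have h8 := h.parse.step a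
  rw [← hab] at h8
  rw [← h.parse.word a, ← h4, ← ha]
  push_cast
  congr 1
  omega

theorem power_ne_nil (a : A) : power σ p a ≠ [] := BratteliSubst.power_ne_nil H.ne_nil p a

theorem isCut_image {b : ℤ → ℤ} {x' : ℤ → A} {k : ℤ} (h : Parse (power σ p) x b x')
    (hk : IsCut w x k) : IsCut w x' (b k) := by
  obtain ⟨j, h1, h2⟩ := hk
  refine ⟨j, ?_, ?_⟩
  · obtain ⟨v, -, hv⟩ := H.image_left j
    have h3 := h.word (k - 1)
    have h4 := h.step (k - 1)
    rw [sub_add_cancel] at h4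
    have h5 := getLast?_factor x' (b (k - 1))
      (List.length_pos_iff.2 (H.power_ne_nil (x (k - 1))))
    rw [h3, ← h4, h1, hv] at h5
    simpa using h5.symm
  · obtain ⟨v, -, hv⟩ := H.image_right j
    have h5 := head?_factor x' (b k) (List.length_pos_iff.2 (H.power_ne_nil (x k)))
    rw [h.word, h2, hv] at h5
    simpa using h5.symm

end BaseData

end ReturnWords

/-! ### The derivative substitution. -/

section Derivative

variable {A : Type u} {σ : A → List A} {m p : ℕ} {w : Fin m → ℤ → A}

/-- The words `d` and `e` can be adjacent: they meet in some `r_j . l_j`. -/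
def Junction (d e : returnWords σ w) : Prop :=
  ∃ j, d.1.getLast? = some (w j (-1)) ∧ e.1.head? = some (w j 0)

/-- The word `e` starts with the first letter of `y`, so the `r_j l_j` at which `d` and `e` meet
would occur inside `d'`. -/
theorem Junction.false_of_append {d e d' : returnWords σ w} (h : Junction d e) {y z t : List A}
    (hd' : d'.1 = d.1 ++ y) (hy : y ≠ []) (he : e.1 ++ z = y ++ t) : False := by
  obtain ⟨j, h1, h2⟩ := h
  refine d'.2.2.2 j ?_
  obtain ⟨a, y, rfl⟩ := List.exists_cons_of_ne_nil hy
  obtain ⟨b, e', hb⟩ := List.exists_cons_of_ne_nil (returnWords_ne_nil e)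
  rw [hb] at h2 he
  simp only [List.head?_cons, Option.some.injEq] at h2
  simp only [List.cons_append, List.cons.injEq] at he
  rw [List.getLast?_eq_some_iff] at h1
  obtain ⟨d0, hd0⟩ := h1
  exact ⟨d0, y, by rw [hd', hd0, ← h2, he.1]; simp⟩

/-- Unique decoding: if two chains had first words of different lengths, the longer one would
contain a junction of the other chain. -/
theorem eq_of_flatMap_eq {D D' : List (returnWords σ w)} (hD : D.IsChain Junction)
    (hD' : D'.IsChain Junction) (h : D.flatMap Subtype.val = D'.flatMap Subtype.val) : D = D' := by
  have aux : ∀ (d d' : returnWords σ w) (D : List (returnWords σ w)) (t : List A),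
      (d :: D).IsChain Junction → d.1 ++ D.flatMap Subtype.val = d'.1 ++ t →
      ¬ d.1.length < d'.1.length := by
    intro d d' D t hc h hlt
    obtain ⟨y, hy⟩ := List.prefix_of_prefix_length_le (List.prefix_append _ _)
      (h ▸ List.prefix_append d'.1 t) hlt.le
    have hy0 : y ≠ [] := by
      rintro rfl
      rw [List.append_nil] at hy
      rw [hy] at hlt
      exact hlt.false
    rw [← hy, List.append_assoc, List.append_cancel_left_eq] at h
    cases D with
    | nil =>
      have := congrArg List.length h
      have h1 := List.length_pos_iff.2 hy0
      simp at this
      omega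
    | cons e D =>
      rw [List.isChain_cons_cons] at hc
      exact hc.1.false_of_append hy.symm hy0 h
  induction D generalizing D' with
  | nil =>
    cases D' with
    | nil => rfl
    | cons d D' => exact absurd h.symm (flatMap_ne_nil returnWords_ne_nil (by simp))
  | cons d D ih =>
    cases D' with
    | nil => exact absurd h (flatMap_ne_nil returnWords_ne_nil (by simp))
    | cons d' D' =>
      rw [List.flatMap_cons, List.flatMap_cons] at h
      have h1 := aux d d' D _ hD h
      have h2 := aux d' d D' _ hD' h.symm
      obtain ⟨h3, h4⟩ := List.append_inj h (by omega)
      rw [Subtype.ext h3, ih (D' := D') hD.tail hD'.tail h4]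

theorem IsDerivative.flatMap_val {s : A → List A} {τ : returnWords σ w → List (returnWords σ w)}
    (h : IsDerivative σ w s τ) (u : returnWords σ w) :
    (τ u).flatMap Subtype.val = u.1.flatMap s := by
  rw [List.flatMap_def, h.flatten]
  rfl

theorem IsDerivative.unique {s : A → List A} {τ τ' : returnWords σ w → List (returnWords σ w)}
    (h : IsDerivative σ w s τ) (h' : IsDerivative σ w s τ') : τ = τ' := by
  funext u
  exact eq_of_flatMap_eq (h.junction u) (h'.junction u) (by rw [h.flatMap_val, h'.flatMap_val])

theorem ReturnParse.isChain_factor {d : ℤ → returnWords σ w} {c : ℤ → ℤ} {x : ℤ → A}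
    (h : ReturnParse d c x) (k : ℤ) (n : ℕ) : (factor d k n).IsChain Junction := by
  induction n generalizing k with
  | zero => exact List.IsChain.nil
  | succ n ih =>
    rw [factor_succ]
    cases n with
    | zero => exact List.IsChain.singleton _
    | succ n =>
      have h1 := ih (k + 1)
      rw [factor_succ] at h1 ⊢
      exact h1.cons_cons (h.junction k)

variable {τ : returnWords σ w → List (returnWords σ w)} {d d' : ℤ → returnWords σ w}
  {c c' : ℤ → ℤ} {x : ℤ → A}

namespace BaseData

variable (H : BaseData σ p w)
include H

/-- Images of cuts are cuts, because `σᵖ(l_j)` starts with `l_j` and `σᵖ(r_j)` ends with `r_j`. So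
the image of a return word runs between two cuts of a point of `X_σ`. -/
theorem exists_derivative : ∃ τ, IsDerivative σ w (power σ p) τ := by
  have key : ∀ u : returnWords σ w, ∃ D : List (returnWords σ w), D ≠ [] ∧
      (D.map Subtype.val).flatten = onWord (power σ p) u.1 ∧ D.IsChain Junction := by
    intro u
    obtain ⟨x, hx, d, c, h, hu⟩ := H.exists_returnParse_of_returnWord u
    obtain ⟨b, x', -, hb⟩ := Parse.exists_image H.power_ne_nil x 0
    obtain ⟨d', c', h'⟩ := H.exists_returnParse (image_mem_space H.ne_nil hx hb)
    obtain ⟨i, hi⟩ := h'.exists_index_of_cut (H.isCut_image hb (h.cut 0))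
    obtain ⟨j, hj⟩ := h'.exists_index_of_cut (H.isCut_image hb (h.cut 1))
    have hij : i < j := h'.strictMono.lt_iff_lt.1 (by
      rw [← hi, ← hj]
      exact hb.strictMono H.power_ne_nil (h.strictMono (by norm_num)))
    refine ⟨factor d' i (j - i).toNat, ?_, ?_, h'.isChain_factor _ _⟩
    · rw [← List.length_pos_iff, length_factor]; omega
    · have h1 := h'.parse.word_nat i (j - i).toNat
      have h2 := h'.parse.step_nat i (j - i).toNat
      have h3 := (hb.comp h.parse).word 0
      have h4 := (hb.comp h.parse).step 0
      simp only [hu, zero_add] at h3 h4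
      rw [show i + ((j - i).toNat : ℤ) = j by omega, ← hi, ← hj] at h2
      rw [← List.flatMap_def, ← h1, ← hi]
      refine Eq.trans ?_ h3
      congr 1
      omega
  choose τ h1 h2 h3 using key
  exact ⟨τ, h1, h2, h3⟩

/-- The images under `τ` of the sequences of return words describe the images under `σᵖ`. -/
theorem image_returnParse (hτ : IsDerivative σ w (power σ p) τ) {b : ℤ → ℤ} {x' : ℤ → A}
    (h : ReturnParse d c x) (hb : Parse (power σ p) x b x') :
    ∃ e d' c', Parse τ d e d' ∧ ReturnParse d' c' x' ∧ ∀ i, b (c i) = c' (e i) := by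
  have h1 := hb.comp h.parse
  rw [show (fun u : returnWords σ w => u.1.flatMap (power σ p)) =
    fun u => (τ u).flatMap Subtype.val from funext fun u => (hτ.flatMap_val u).symm] at h1
  obtain ⟨e, d', c', h2, h3, h4⟩ := h1.decomp hτ.ne_nil returnWords_ne_nil
  refine ⟨e, d', c', h2, ⟨h3, fun k => ?_⟩, h4⟩
  obtain ⟨i, hi, hi'⟩ := h2.exists_index hτ.ne_nil k
  -- A cut of the image either is the image of a cut of `x`, or lies inside one `τ (d i)`, where it
  -- is a junction of the derivative.
  rcases hi.eq_or_lt with rfl | hlt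
  · rw [← h4]
    exact H.isCut_image hb (h.cut i)
  · have h5 := h2.word i
    have h6 := h2.step i
    have h7 := hτ.junction (d i)
    rw [List.isChain_iff_getElem] at h7
    obtain ⟨j, hj1, hj2⟩ := h7 (k - 1 - e i).toNat (by omega)
    have h8 := h2.getElem?_word (i := i) (j := (k - 1 - e i).toNat) (by omega)
    have h9 := h2.getElem?_word (i := i) (j := (k - 1 - e i).toNat + 1) (by omega)
    rw [List.getElem?_eq_getElem (by omega), Option.some.injEq] at h8 h9
    rw [h8, show e i + ((k - 1 - e i).toNat : ℤ) = k - 1 by omega] at hj1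
    rw [h9, show e i + (((k - 1 - e i).toNat + 1 : ℕ) : ℤ) = k by push_cast; omega] at hj2
    have h10 := h3.step (k - 1)
    rw [sub_add_cancel] at h10
    have h11 := getLast?_factor x' (c' (k - 1))
      (List.length_pos_iff.2 (returnWords_ne_nil (d' (k - 1))))
    have h12 := head?_factor x' (c' k) (List.length_pos_iff.2 (returnWords_ne_nil (d' k)))
    rw [h3.word, hj1, ← h10] at h11
    rw [h3.word, hj2] at h12
    exact ⟨j, (Option.some.inj h11).symm, (Option.some.inj h12).symm⟩

theorem image_mem_returnSpace (hτ : IsDerivative σ w (power σ p) τ) (hd : d ∈ returnSpace σ w)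
    (h : Parse τ d c d') : d' ∈ returnSpace σ w := by
  obtain ⟨x, hx, b, hb⟩ := hd
  obtain ⟨a, x', -, ha⟩ := Parse.exists_image H.power_ne_nil x 0
  obtain ⟨e, d1, c1, h1, h2, -⟩ := H.image_returnParse hτ hb ha
  have h3 := h1.translate (e 0 - c 0)
  obtain ⟨-, h4⟩ := h.unique hτ.ne_nil h3 (by simp)
  rw [h4]
  exact reindex_mem_returnSpace ⟨x', image_mem_space H.ne_nil hx ha, c1, h2⟩ _

theorem exists_preimage_returnSpace (hτ : IsDerivative σ w (power σ p) τ)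
    (hd : d ∈ returnSpace σ w) : ∃ d' ∈ returnSpace σ w, ∃ e, Parse τ d' e d := by
  obtain ⟨x, hx, c, h⟩ := hd
  obtain ⟨y, hy, b, hb⟩ := H.preimage x hx
  obtain ⟨d', c', h'⟩ := H.exists_returnParse hy
  obtain ⟨e, d1, c1, h1, h2, -⟩ := H.image_returnParse hτ h' hb
  obtain ⟨δ, hδ⟩ := h.unique h2
  have h3 := h1.translate δ
  rw [show (fun i => d1 (i + δ)) = d from funext fun i => (hδ i).1] at h3
  exact ⟨d', ⟨y, hy, c', h'⟩, _, h3⟩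

/-- Spelled out over `A`, two `τ`-parses become two `σᵖ`-parses of one sequence `z`. These agree by
recognizability of `σᵖ`, and cutting into return words is unique. -/
theorem recognizable_derivative (hτ : IsDerivative σ w (power σ p) τ) :
    Recognizable τ (returnSpace σ w) := by
  intro d₁ hd₁ d₂ hd₂ e₁ e₂ d h₁ h₂
  obtain ⟨f, z, -, hz⟩ := Parse.exists_image returnWords_ne_nil d 0
  have key : ∀ d₁ ∈ returnSpace σ w, ∀ e₁, Parse τ d₁ e₁ d → ∃ x ∈ space σ, ∃ c b,
      ReturnParse d₁ c x ∧ Parse (power σ p) x b z ∧ ∀ i, f (e₁ i) = b (c i) := by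
    intro d₁ hd₁ e₁ h₁
    have h3 := hz.comp h₁
    rw [show (fun u => (τ u).flatMap Subtype.val) =
      fun u : returnWords σ w => u.1.flatMap (power σ p) from funext hτ.flatMap_val] at h3
    obtain ⟨c, x, b, h4, h5, h6⟩ := h3.decomp returnWords_ne_nil H.power_ne_nil
    obtain ⟨h7, h8⟩ := returnParse_of_parse hd₁ h4
    exact ⟨x, h7, c, b, h8, h5, h6⟩
  obtain ⟨x₁, hx₁, c₁, b₁, hc₁, hb₁, hf₁⟩ := key d₁ hd₁ e₁ h₁
  obtain ⟨x₂, hx₂, c₂, b₂, hc₂, hb₂, hf₂⟩ := key d₂ hd₂ e₂ h₂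
  obtain ⟨δ, hδ⟩ := H.recog x₁ hx₁ x₂ hx₂ b₁ b₂ z hb₁ hb₂
  have h3 := hc₂.translate δ
  rw [show (fun i => x₂ (i + δ)) = x₁ from funext fun i => (hδ i).1] at h3
  obtain ⟨ε, hε⟩ := hc₁.unique h3
  refine ⟨ε, fun i => ⟨(hε i).1, hz.strictMono_return.injective ?_⟩⟩
  rw [hf₁, hf₂, ← (hδ (c₁ i)).2, ← (hε i).2, sub_add_cancel]

end BaseData

end Derivative

/-! ### Towers of desubstitutions: existence, uniqueness, continuity, injectivity. -/

section Tower

variable {A : Type u} {σ : A → List A} {m p : ℕ} {w : Fin m → ℤ → A}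
  {τ : returnWords σ w → List (returnWords σ w)}

/-- The sequence of centred desubstitutions of a point of `X_σ`. -/
structure IsTower (τ : returnWords σ w → List (returnWords σ w)) (x : ℤ → A)
    (d : ℕ → ℤ → returnWords σ w) (c : ℕ → ℤ → ℤ) : Prop where
  zero : Parse Subtype.val (d 0) (c 0) x
  succ : ∀ n, Parse τ (d (n + 1)) (c (n + 1)) (d n)
  mem : ∀ n, d n ∈ returnSpace σ w
  centered : ∀ n, Centered (c n)

/-- Recognizability leaves only a change of index open, and centring forces it to be zero. -/
theorem Recognizable.unique_centered {A B : Type*} {f : A → List B} (hf : ∀ a, f a ≠ [])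
    {X : Set (ℤ → A)} (hr : Recognizable f X) {y y' : ℤ → A} (hy : y ∈ X) (hy' : y' ∈ X)
    {c c' : ℤ → ℤ} {x : ℤ → B} (h : Parse f y c x) (h' : Parse f y' c' x) (hc : Centered c)
    (hc' : Centered c') : y = y' ∧ c = c' := by
  obtain ⟨δ, hδ⟩ := hr y hy y' hy' c c' x h h'
  have h1 := (hδ 0).2
  have h2 := (hδ 1).2
  rw [zero_add] at h1
  rw [add_comm] at h2
  have : δ = 0 := Parse.index_unique (h'.strictMono hf) (k := 0) (by rw [h1]; exact hc.1)
    (by rw [h2]; exact hc.2) hc'.1 hc'.2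
  subst this
  exact ⟨funext fun i => by simpa using (hδ i).1.symm,
    funext fun i => by simpa using (hδ i).2.symm⟩

theorem recognizable_val : Recognizable (Subtype.val : returnWords σ w → List A)
    (returnSpace σ w) := by
  intro d hd d' hd' c c' x h h'
  exact (returnParse_of_parse hd h).2.unique (returnParse_of_parse hd' h').2

theorem Centered.comp {c e : ℤ → ℤ} (hm : StrictMono c) (hc : Centered c) (he : Centered e) :
    Centered fun i => c (e i) :=
  ⟨(hm.monotone he.1).trans hc.1,
    hc.2.trans_le (hm.monotone (by have := he.2; omega))⟩

theorem Parse.exists_reindex_centered {A B : Type*} {f : A → List B} (hf : ∀ a, f a ≠ [])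
    {y : ℤ → A} {c : ℤ → ℤ} {x : ℤ → B} (h : Parse f y c x) :
    ∃ i c', Parse f (fun j => y (j + i)) c' x ∧ Centered c' := by
  obtain ⟨i, hi⟩ := h.exists_centered hf
  exact ⟨i, _, h.reindex i, hi⟩

variable (H : BaseData σ p w) (hτ : IsDerivative σ w (power σ p) τ)
include H hτ

theorem exists_isTower {x : ℤ → A} (hx : x ∈ space σ) : ∃ d c, IsTower τ x d c := by
  obtain ⟨d0, c0, h0⟩ := H.exists_returnParse hx
  obtain ⟨i0, c0', h0', hc0⟩ := h0.parse.exists_reindex_centered returnWords_ne_nil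
  have hd0 : (fun j => d0 (j + i0)) ∈ returnSpace σ w :=
    reindex_mem_returnSpace ⟨x, hx, c0, h0⟩ i0
  have key : ∀ d : returnSpace σ w, ∃ d' : returnSpace σ w, ∃ c, Parse τ d'.1 c d.1 ∧
      Centered c := by
    rintro ⟨d, hd⟩
    obtain ⟨d', hd', e, he⟩ := H.exists_preimage_returnSpace hτ hd
    obtain ⟨i, c, h1, h2⟩ := he.exists_reindex_centered hτ.ne_nil
    exact ⟨⟨_, reindex_mem_returnSpace hd' i⟩, c, h1, h2⟩
  choose F C hF hC using key
  let t : ℕ → returnSpace σ w := fun n => F^[n] ⟨_, hd0⟩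
  have ht : ∀ n, t (n + 1) = F (t n) := fun n => Function.iterate_succ_apply' ..
  refine ⟨fun n => (t n).1, fun n => match n with | 0 => c0' | n + 1 => C (t n), h0', fun n => ?_,
    fun n => (t n).2, fun n => ?_⟩
  · simp only [ht]
    exact hF _
  · cases n with
    | zero => exact hc0
    | succ n => exact hC _

/-- Uniqueness of the tower, level by level. -/
theorem IsTower.unique {x : ℤ → A} {d d' : ℕ → ℤ → returnWords σ w} {c c' : ℕ → ℤ → ℤ}
    (h : IsTower τ x d c) (h' : IsTower τ x d' c') (n : ℕ) : d n = d' n ∧ c n = c' n := by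
  induction n with
  | zero =>
    exact recognizable_val.unique_centered returnWords_ne_nil (h.mem 0) (h'.mem 0) h.zero
      h'.zero (h.centered 0) (h'.centered 0)
  | succ n ih =>
    have h1 := h'.succ n
    rw [← ih.1] at h1
    exact (H.recognizable_derivative hτ).unique_centered hτ.ne_nil (h.mem _) (h'.mem _)
      (h.succ n) h1 (h.centered _) (h'.centered _)

omit H hτ in
theorem IsCut.of_limit {ι : Type*} {U : Ultrafilter ι} {X : ι → ℤ → A} {x : ℤ → A}
    {k : ℤ} (hX : ∀ k, ∀ᶠ n in U, X n k = x k) (h : ∀ᶠ n in U, IsCut w (X n) k) :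
    IsCut w x k := by
  obtain ⟨n, ⟨j, h1, h2⟩, h3, h4⟩ := (h.and ((hX (k - 1)).and (hX k))).exists
  exact ⟨j, by rw [← h3, h1], by rw [← h4, h2]⟩

omit hτ in
theorem mem_returnSpace_of_limit [Finite A] {ι : Type*} {U : Ultrafilter ι}
    {D : ι → ℤ → returnWords σ w} {d : ℤ → returnWords σ w}
    (hD : ∀ᶠ n in U, D n ∈ returnSpace σ w) (hd : ∀ i, ∀ᶠ n in U, D n i = d i) :
    d ∈ returnSpace σ w := by
  have : Finite (returnWords σ w) := H.finite_returnWords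
  choose C X hC hP using fun n => Parse.exists_image returnWords_ne_nil (D n) 0
  have hx : ∀ k, ∃ a, ∀ᶠ n in U, X n k = a := fun k =>
    eventually_eq_of_finite U Set.finite_univ _ (by simp)
  choose x hx using hx
  have hR : ∀ᶠ n in U, X n ∈ space σ ∧ ReturnParse (D n) (C n) (X n) := by
    filter_upwards [hD] with n hn
    exact returnParse_of_parse hn (hP n)
  obtain ⟨y, c, h1, -, h2, h3⟩ := Parse.exists_limit U (Filter.Eventually.of_forall hP)
    (Filter.Eventually.of_forall fun n => ⟨(hC n).le, by
      rw [← hC n]; exact (hP n).strictMono_return (by norm_num)⟩) hx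
  have hyd : y = d := by
    funext i
    obtain ⟨n, h4, h5⟩ := ((h2 i).and (hd i)).exists
    rw [← h4, h5]
  subst hyd
  refine ⟨x, mem_space_of_limit (hR.mono fun _ h => h.1) hx, c, h1, fun i => ?_⟩
  refine IsCut.of_limit hx ?_
  filter_upwards [hR, h3 i] with n h4 h5
  rw [← h5]
  exact h4.2.cut i

/-- The tower depends continuously on the point. -/
theorem IsTower.limit [Finite A] {ι : Type*} {U : Ultrafilter ι} {X : ι → ℤ → A} {x : ℤ → A}
    {D : ι → ℕ → ℤ → returnWords σ w} {C : ι → ℕ → ℤ → ℤ} {d : ℕ → ℤ → returnWords σ w}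
    {c : ℕ → ℤ → ℤ} (hT : ∀ n, IsTower τ (X n) (D n) (C n)) (h : IsTower τ x d c)
    (hX : ∀ k, ∀ᶠ n in U, X n k = x k) (l : ℕ) :
    (∀ i, ∀ᶠ n in U, D n l i = d l i) ∧ ∀ i, ∀ᶠ n in U, C n l i = c l i := by
  have : Finite (returnWords σ w) := H.finite_returnWords
  induction l with
  | zero =>
    obtain ⟨y, b, h1, h2, h3, h4⟩ := Parse.exists_limit U
      (Filter.Eventually.of_forall fun n => (hT n).zero)
      (Filter.Eventually.of_forall fun n => (hT n).centered 0) hX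
    have h5 := mem_returnSpace_of_limit H (Filter.Eventually.of_forall fun n => (hT n).mem 0) h3
    obtain ⟨rfl, rfl⟩ := recognizable_val.unique_centered returnWords_ne_nil h5 (h.mem 0) h1 h.zero
      h2 (h.centered 0)
    exact ⟨h3, h4⟩
  | succ l ih =>
    obtain ⟨y, b, h1, h2, h3, h4⟩ := Parse.exists_limit U
      (Filter.Eventually.of_forall fun n => (hT n).succ l)
      (Filter.Eventually.of_forall fun n => (hT n).centered (l + 1)) ih.1
    have h5 := mem_returnSpace_of_limit H
      (Filter.Eventually.of_forall fun n => (hT n).mem (l + 1)) h3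
    obtain ⟨rfl, rfl⟩ := (H.recognizable_derivative hτ).unique_centered hτ.ne_nil h5 (h.mem _) h1
      (h.succ l) h2 (h.centered _)
    exact ⟨h3, h4⟩

/-- A sequence of return words is the level `n` of the tower of a point with prescribed
cuts below. -/
theorem exists_isTower_level {v : ℕ → returnWords σ w} {k : ℕ → ℕ} (h0 : k 0 < (v 0).1.length)
    (hv : ∀ n, (τ (v (n + 1)))[k (n + 1)]? = some (v n)) (n : ℕ) {e : ℤ → returnWords σ w}
    (he : e ∈ returnSpace σ w) (hen : e 0 = v n) :
    ∃ x ∈ space σ, ∃ d c, IsTower τ x d c ∧ d n = e ∧ ∀ i ≤ n, d i 0 = v i ∧ c i 0 = -(k i : ℤ) := by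
  induction n generalizing e with
  | zero =>
    obtain ⟨b, x, hb0, hb⟩ := Parse.exists_image returnWords_ne_nil e (-(k 0 : ℤ))
    obtain ⟨hx, -⟩ := returnParse_of_parse he hb
    obtain ⟨d, c, h⟩ := exists_isTower H hτ hx
    have h1 := hb.step 0
    rw [zero_add, hen] at h1
    obtain ⟨rfl, rfl⟩ := recognizable_val.unique_centered returnWords_ne_nil he (h.mem 0) hb h.zero
      ⟨by omega, by omega⟩ (h.centered 0)
    refine ⟨x, hx, d, c, h, rfl, fun i hi => ?_⟩
    obtain rfl : i = 0 := by omega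
    exact ⟨hen, hb0⟩
  | succ n ih =>
    obtain ⟨b, e', hb0, hb⟩ := Parse.exists_image hτ.ne_nil e (-(k (n + 1) : ℤ))
    have hk : k (n + 1) < (τ (v (n + 1))).length := (List.getElem?_eq_some_iff.1 (hv n)).1
    have h2 := hb.getElem?_word (i := 0) (j := k (n + 1)) (by rw [hen]; exact hk)
    rw [hen, hv n, hb0, neg_add_cancel, Option.some.injEq] at h2
    obtain ⟨x, hx, d, c, h, rfl, hdc⟩ := ih (H.image_mem_returnSpace hτ he hb) h2.symm
    have h1 := hb.step 0
    rw [zero_add, hen] at h1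
    obtain ⟨rfl, rfl⟩ := (H.recognizable_derivative hτ).unique_centered hτ.ne_nil he (h.mem _) hb
      (h.succ n) ⟨by omega, by omega⟩ (h.centered _)
    refine ⟨x, hx, d, c, h, rfl, fun i hi => ?_⟩
    rcases Nat.le_succ_iff.1 hi with hi | rfl
    · exact hdc i hi
    · exact ⟨hen, hb0⟩

/-- Every finite initial piece of the path is realised by the tower of some point. By continuity of
towers, the tower of a limit of these points realises the whole path. -/
theorem exists_isTower_of_path [Finite A] {v : ℕ → returnWords σ w} {k : ℕ → ℕ}
    (h0 : k 0 < (v 0).1.length) (hv : ∀ n, (τ (v (n + 1)))[k (n + 1)]? = some (v n)) :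
    ∃ x ∈ space σ, ∃ d c, IsTower τ x d c ∧ ∀ n, d n 0 = v n ∧ c n 0 = -(k n : ℤ) := by
  have key : ∀ n, ∃ x ∈ space σ, ∃ d c, IsTower τ x d c ∧
      ∀ i ≤ n, d i 0 = v i ∧ c i 0 = -(k i : ℤ) := by
    intro n
    obtain ⟨x, hx, e, c, h, he⟩ := H.exists_returnParse_of_returnWord (v n)
    obtain ⟨x, hx, d, c, h1, -, h2⟩ := exists_isTower_level H hτ h0 hv n ⟨x, hx, c, h⟩ he
    exact ⟨x, hx, d, c, h1, h2⟩
  choose X hX D C hT hDC using key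
  have hx : ∀ k, ∃ a, ∀ᶠ n in Filter.hyperfilter ℕ, X n k = a := fun k =>
    eventually_eq_of_finite _ Set.finite_univ _ (by simp)
  choose x hx using hx
  have hxs : x ∈ space σ := mem_space_of_limit (Filter.Eventually.of_forall hX) hx
  obtain ⟨d, c, h⟩ := exists_isTower H hτ hxs
  refine ⟨x, hxs, d, c, h, fun n => ?_⟩
  obtain ⟨h1, h2⟩ := IsTower.limit H hτ hT h hx n
  have h3 : ∀ᶠ l in Filter.hyperfilter ℕ, n ≤ l :=
    Nat.hyperfilter_le_atTop (Filter.eventually_ge_atTop n)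
  obtain ⟨l, h4, h5, h6⟩ := ((h1 0).and ((h2 0).and h3)).exists
  rw [← h4, ← h5]
  exact hDC l n h6

omit H in
/-- The tower of the shifted point: an odometer with carry. -/
theorem IsTower.shift {x : ℤ → A} {d : ℕ → ℤ → returnWords σ w} {c : ℕ → ℤ → ℤ}
    (h : IsTower τ x d c) : ∃ d' c', IsTower τ (shift x) d' c' ∧ ∀ n,
      ((∀ i < n, c i 1 = 1) → c n 1 = 1 → c' n 0 = 0) ∧
      ((∀ i < n, c i 1 = 1) → c n 1 ≠ 1 → d' n = d n ∧ c' n 0 = c n 0 - 1) ∧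
      ((∃ i < n, c i 1 ≠ 1) → d' n = d n ∧ c' n = c n) := by
  classical
  -- `c i 1 = 1` means that the origin is the last position of its word at level `i`. If this holds
  -- at all levels below `n`, the carry reaches level `n` and the sequence beneath it moves on by
  -- one index.
  let carry : ℕ → Prop := fun n => ∀ i < n, c i 1 = 1
  have hcs : ∀ n, carry (n + 1) ↔ carry n ∧ c n 1 = 1 := fun n => by
    simp only [carry, Nat.forall_lt_succ_right]
  let d' : ℕ → ℤ → returnWords σ w := fun n =>
    if carry (n + 1) then fun i => d n (i + 1) else d n
  let c' : ℕ → ℤ → ℤ := fun n => if carry (n + 1) then fun i => c n (i + 1) - 1 else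
    if carry n then fun i => c n i - 1 else c n
  have step : ∀ {B : Type u} {f : returnWords σ w → List B} {z : ℤ → B} (n : ℕ), (∀ a, f a ≠ []) →
      Parse f (d n) (c n) z →
      Parse f (d' n) (c' n) (if carry n then fun i => z (i + 1) else z) ∧ Centered (c' n) := by
    intro B f z n hf hp
    have hcen := h.centered n
    by_cases h1 : carry (n + 1)
    · have h2 := (hcs n).1 h1
      simp only [d', c', if_pos h1, if_pos h2.1]
      refine ⟨(hp.translate 1).reindex 1, by simp [h2.2], ?_⟩
      have := hp.strictMono hf (show (1 : ℤ) < 1 + 1 by norm_num)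
      rw [h2.2] at this
      simpa using this
    · by_cases h2 : carry n
      · have h3 : c n 1 ≠ 1 := fun h3 => h1 ((hcs n).2 ⟨h2, h3⟩)
        simp only [d', c', if_neg h1, if_pos h2]
        exact ⟨hp.translate 1, by have := hcen.1; simp only; omega, by have := hcen.2; simp only; omega⟩
      · simp only [d', c', if_neg h1, if_neg h2]
        exact ⟨hp, hcen⟩
  refine ⟨d', c', ⟨?_, fun n => ?_, fun n => ?_, fun n => ?_⟩, fun n => ⟨?_, ?_, ?_⟩⟩
  · have := (step 0 returnWords_ne_nil h.zero).1
    rwa [if_pos (show carry 0 from fun i hi => absurd hi (Nat.not_lt_zero i))] at this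
  · exact (step (n + 1) hτ.ne_nil (h.succ n)).1
  · by_cases h1 : carry (n + 1)
    · simp only [d', if_pos h1]
      exact reindex_mem_returnSpace (h.mem n) 1
    · simp only [d', if_neg h1]
      exact h.mem n
  · cases n with
    | zero => exact (step 0 returnWords_ne_nil h.zero).2
    | succ n => exact (step (n + 1) hτ.ne_nil (h.succ n)).2
  · intro h1 h2
    simp [c', if_pos ((hcs n).2 ⟨h1, h2⟩), h2]
  · intro h1 h2
    have h3 : ¬ carry (n + 1) := fun h3 => h2 ((hcs n).1 h3).2
    simp only [d', c', if_neg h3, if_pos (show carry n from h1), and_self]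
  · rintro ⟨i, hi, hne⟩
    have h3 : ¬ carry (n + 1) := fun h3 => hne (h3 i (by omega))
    have h4 : ¬ carry n := fun h3 => hne (h3 i hi)
    simp only [d', c', if_neg h3, if_neg h4, and_self]

omit H in
/-- The words `τⁿ(u)`, read as words over `A`, are the words `σᵖⁿ(u)`. -/
theorem flatMap_power_derivative (n : ℕ) (u : returnWords σ w) :
    (power τ n u).flatMap Subtype.val = u.1.flatMap (power (power σ p) n) := by
  induction n with
  | zero => simp [show power (power σ p) 0 = fun a => [a] from rfl]
  | succ n ih =>
    rw [power_succ, List.flatMap_assoc]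
    simp only [hτ.flatMap_val]
    rw [← List.flatMap_assoc, ih, List.flatMap_assoc]
    congr 1
    funext a
    rw [power_succ]

omit hτ in
-- Linear growth suffices: with `n = |t|`, coordinate `t` is covered once the central word and these
-- words on its two sides are known.
theorem power_base_right (i : Fin m) (n : ℕ) :
    n + 1 ≤ (power (power σ p) n (w i 0)).length := by
  induction n with
  | zero => simp
  | succ n ih =>
    obtain ⟨v, hv, h⟩ := H.image_right i
    have h1 := List.length_pos_iff.2 hv
    have h2 := length_le_length_flatMap (BratteliSubst.power_ne_nil H.power_ne_nil n) v
    rw [add_comm n 1, power_add, power_one, h, List.flatMap_cons, List.length_append]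
    omega

omit hτ in
theorem power_base_left (i : Fin m) (n : ℕ) :
    n + 1 ≤ (power (power σ p) n (w i (-1))).length := by
  induction n with
  | zero => simp
  | succ n ih =>
    obtain ⟨v, hv, h⟩ := H.image_left i
    have h1 := List.length_pos_iff.2 hv
    have h2 := length_le_length_flatMap (BratteliSubst.power_ne_nil H.power_ne_nil n) v
    rw [add_comm n 1, power_add, power_one, h, List.flatMap_append, List.length_append]
    simp only [List.flatMap_singleton]
    omega

theorem IsTower.exists_composite {x x' : ℤ → A} {d d' : ℕ → ℤ → returnWords σ w}
    {c c' : ℕ → ℤ → ℤ} (h : IsTower τ x d c) (h' : IsTower τ x' d' c')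
    (hd : ∀ n, d n 0 = d' n 0) (hc : ∀ n, c n 0 = c' n 0) (n : ℕ) :
    ∃ K K', Parse (fun u : returnWords σ w => u.1.flatMap (power (power σ p) n)) (d n) K x ∧
      Parse (fun u : returnWords σ w => u.1.flatMap (power (power σ p) n)) (d' n) K' x' ∧
      Centered K ∧ Centered K' ∧ K 0 = K' 0 := by
  induction n with
  | zero =>
    have : (fun u : returnWords σ w => u.1.flatMap (power (power σ p) 0)) = Subtype.val := by
      funext u
      rw [← flatMap_power_derivative hτ]
      simp
    rw [this]
    exact ⟨_, _, h.zero, h'.zero, h.centered 0, h'.centered 0, hc 0⟩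
  | succ n ih =>
    obtain ⟨K, K', h1, h2, h3, h4, h5⟩ := ih
    have hf : ∀ u : returnWords σ w, u.1.flatMap (power (power σ p) n) ≠ [] := fun u =>
      flatMap_ne_nil (BratteliSubst.power_ne_nil H.power_ne_nil n) (returnWords_ne_nil u)
    have e : (fun u : returnWords σ w => u.1.flatMap (power (power σ p) (n + 1))) =
        fun u => (τ u).flatMap fun u : returnWords σ w => u.1.flatMap (power (power σ p) n) := by
      funext u
      rw [← List.flatMap_assoc, hτ.flatMap_val, List.flatMap_assoc]
      congr 1
      funext a
      rw [add_comm, power_add, power_one]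
    rw [e]
    refine ⟨_, _, h1.comp (h.succ n), h2.comp (h'.succ n),
      h3.comp (h1.strictMono hf) (h.centered _), h4.comp (h2.strictMono hf) (h'.centered _), ?_⟩
    -- The same word `τ (d (n + 1) 0)` is read around the origin in both towers, so the letters of
    -- level `n` to the left of index `0` in it agree, and hence the left ends of the composite
    -- words do.
    have h6 := (h.succ n).agree (h'.succ n) (hc (n + 1)) (a := 0) (b := 1) le_rfl zero_le_one
      fun i hi hi' => by
        obtain rfl : i = 0 := by omega
        exact hd (n + 1)
    have h7 := h.centered (n + 1)
    have h8 := h1.agree_cut h2 h5 h7.1 le_rfl fun i hi hi' => h6.2 i hi (hi'.trans h7.2)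
    rw [← hc (n + 1)]
    exact h8 _ le_rfl h7.1

/-- A point is determined by the path of its tower. -/
theorem IsTower.injective {x x' : ℤ → A} {d d' : ℕ → ℤ → returnWords σ w}
    {c c' : ℕ → ℤ → ℤ} (h : IsTower τ x d c) (h' : IsTower τ x' d' c')
    (hd : ∀ n, d n 0 = d' n 0) (hc : ∀ n, c n 0 = c' n 0) : x = x' := by
  funext t
  obtain ⟨K, K', h1, h2, h3, h4, h5⟩ := h.exists_composite H hτ h' hd hc t.natAbs
  have hag := h1.agree h2 h5 (a := 0) (b := 1) le_rfl zero_le_one fun i hi hi' => by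
    obtain rfl : i = 0 := by omega
    exact hd _
  have hjun : ∀ {d : ℕ → ℤ → returnWords σ w} {c : ℕ → ℤ → ℤ} {x : ℤ → A}, IsTower τ x d c →
      ∀ i, ∃ j, (d t.natAbs i).1.getLast? = some (w j (-1)) ∧
        (d t.natAbs (i + 1)).1.head? = some (w j 0) := by
    intro d c x h i
    obtain ⟨z, -, b, hb⟩ := h.mem t.natAbs
    exact hb.junction i
  have hK0 := h3.1
  have hK1 := h3.2
  rcases lt_or_ge t (K 0) with hlt | hge
  · obtain ⟨j, hj1, hj2⟩ := hjun h (-1)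
    obtain ⟨j', hj1', hj2'⟩ := hjun h' (-1)
    rw [neg_add_cancel] at hj2 hj2'
    rw [← hd, hj2, Option.some.injEq] at hj2'
    obtain rfl := H.inj_right _ _ hj2'
    have key : ∀ {d : ℤ → returnWords σ w} {K : ℤ → ℤ} {x : ℤ → A},
        Parse (fun u : returnWords σ w => u.1.flatMap (power (power σ p) t.natAbs)) d K x →
        (d (-1)).1.getLast? = some (w j (-1)) →
        factor x (K 0 - (power (power σ p) t.natAbs (w j (-1))).length)
          (power (power σ p) t.natAbs (w j (-1))).length =
          power (power σ p) t.natAbs (w j (-1)) := by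
      intro d K x hp hl
      rw [List.getLast?_eq_some_iff] at hl
      obtain ⟨v, hv⟩ := hl
      have h6 := hp.word (-1)
      have h7 := hp.step (-1)
      rw [neg_add_cancel] at h7
      simp only [hv, List.flatMap_append, List.flatMap_singleton] at h6 h7
      rw [List.length_append] at h7
      have h8 := (factor_eq_append h6).2
      rw [show K 0 - ((power (power σ p) t.natAbs (w j (-1))).length : ℤ) =
        K (-1) + (List.flatMap (power (power σ p) t.natAbs) v).length by push_cast at h7; omega]
      exact h8
    have h6 := key h1 hj1
    have h7 := key h2 hj1'
    have h8 := power_base_left H j t.natAbs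
    rw [← h5] at h7
    have h9 := eq_of_factor_eq (h6.trans h7.symm)
      (i := (t - (K 0 - (power (power σ p) t.natAbs (w j (-1))).length)).toNat) (by omega)
    rwa [Int.toNat_of_nonneg (by omega), add_sub_cancel] at h9
  rcases lt_or_ge t (K 1) with hlt | hge'
  · exact hag.2 t hge hlt
  -- Right of the central word: the last letter `r_j` forces both right neighbours to start with
  -- `l_j`.
  · obtain ⟨j, hj1, hj2⟩ := hjun h 0
    obtain ⟨j', hj1', hj2'⟩ := hjun h' 0
    rw [zero_add] at hj2 hj2'
    rw [← hd, hj1, Option.some.injEq] at hj1'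
    obtain rfl := H.inj_left _ _ hj1'
    have key : ∀ {d : ℤ → returnWords σ w} {K : ℤ → ℤ} {x : ℤ → A},
        Parse (fun u : returnWords σ w => u.1.flatMap (power (power σ p) t.natAbs)) d K x →
        (d 1).1.head? = some (w j 0) →
        factor x (K 1) (power (power σ p) t.natAbs (w j 0)).length =
          power (power σ p) t.natAbs (w j 0) := by
      intro d K x hp hl
      rw [List.head?_eq_some_iff] at hl
      obtain ⟨v, hv⟩ := hl
      have h6 := hp.word 1
      simp only [hv, List.flatMap_cons] at h6
      exact (factor_eq_append h6).1
    have h6 := key h1 hj2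
    have h7 := key h2 hj2'
    have h8 := power_base_right H j t.natAbs
    rw [← hag.1 1 zero_le_one le_rfl] at h7
    have h9 := eq_of_factor_eq (h6.trans h7.symm) (i := (t - K 1).toNat) (by omega)
    rwa [Int.toNat_of_nonneg (by omega), add_sub_cancel] at h9

end Tower

/-! ### Consequences of `m`-primitivity, and existence of base points. -/

section MPrimitive

variable {A : Type u} {σ : A → List A} {m : ℕ} {C : Fin m → Set A}

theorem infix_flatMap_of_mem {A B : Type*} {f : A → List B} {u : List A} {a : A} (h : a ∈ u) :
    f a <:+: u.flatMap f := by
  obtain ⟨s, t, rfl⟩ := List.append_of_mem h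
  exact ⟨s.flatMap f, t.flatMap f, by simp⟩

namespace IsMPrimitive

variable (hC : IsMPrimitive σ m C)
include hC

theorem mem_of_mem_power {i : Fin m} {n : ℕ} {a b : A} (ha : a ∈ C i) (hb : b ∈ power σ n a) :
    b ∈ C i := by
  induction n generalizing b with
  | zero =>
    obtain rfl : b = a := by simpa using hb
    exact ha
  | succ n ih =>
    rw [power_succ, List.mem_flatMap] at hb
    obtain ⟨c, hc, hb⟩ := hb
    exact hC.maps i c (ih hc) b hb

theorem exists_forall_mem_power (hσ : ∀ a, σ a ≠ []) (i : Fin m) :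
    ∃ n, ∀ N, n ≤ N → ∀ a ∈ C i, ∀ b ∈ C i, b ∈ power σ N a := by
  obtain ⟨n, -, hn⟩ := hC.primitive i
  refine ⟨n, fun N hN a ha b hb => ?_⟩
  obtain ⟨k, rfl⟩ := Nat.exists_eq_add_of_le' hN
  obtain ⟨c, hc⟩ := List.exists_mem_of_ne_nil _ (power_ne_nil hσ k a)
  rw [power_add, List.mem_flatMap]
  exact ⟨c, hc, hn c (hC.mem_of_mem_power ha hc) b hb⟩

/-- Otherwise `a` would produce only itself, while primitivity makes it produce all of the at least
two letters of `C i`. -/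
theorem power_ne_singleton (hσ : ∀ a, σ a ≠ []) {p : ℕ} (hp : 0 < p) {i : Fin m} {a : A}
    (ha : a ∈ C i) : power σ p a ≠ [a] := by
  intro h
  have h1 : ∀ n, power (power σ p) n a = [a] := by
    intro n
    induction n with
    | zero => rfl
    | succ n ih => rw [power_succ, ih]; simpa using h
  obtain ⟨n, hn⟩ := hC.exists_forall_mem_power hσ i
  have h2 : C i ⊆ {a} := by
    intro b hb
    have := hn (p * n) (Nat.le_mul_of_pos_left n hp) a ha b hb
    rw [← power_power, h1] at this
    simpa using this
  have h3 := Set.ncard_le_ncard h2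
  have h4 := hC.two_le i
  rw [Set.ncard_singleton] at h3
  omega

theorem eq_of_mem {i j : Fin m} {a : A} (hi : a ∈ C i) (hj : a ∈ C j) : i = j := by
  by_contra hne
  exact Set.disjoint_left.1 (hC.disjoint hne) hi hj

end IsMPrimitive

namespace IsBaseChoice

variable {p : ℕ} {w : Fin m → ℤ → A}

theorem exists_pair (h : IsBaseChoice σ C p w) (i : Fin m) :
    ∃ a ∈ C i, ∃ k, [w i (-1), w i 0] <:+: power σ k a := by
  obtain ⟨a, ha, k, hk⟩ := (h.mem i).2 1
  refine ⟨a, ha, k, List.IsInfix.trans ?_ hk⟩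
  rw [pair_infix_factor]
  exact ⟨0, by norm_num, by norm_num, by norm_num, rfl⟩

theorem left_mem (h : IsBaseChoice σ C p w) (hC : IsMPrimitive σ m C) (i : Fin m) :
    w i (-1) ∈ C i := by
  obtain ⟨a, ha, k, hk⟩ := h.exists_pair i
  exact hC.mem_of_mem_power ha (hk.subset (by simp))

theorem right_mem (h : IsBaseChoice σ C p w) (hC : IsMPrimitive σ m C) (i : Fin m) :
    w i 0 ∈ C i := by
  obtain ⟨a, ha, k, hk⟩ := h.exists_pair i
  exact hC.mem_of_mem_power ha (hk.subset (by simp))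

/-- Some power of `a` meets a component, where primitivity produces every letter and hence the base
pair. Validity for all large `N` lets one exponent serve all letters. -/
theorem exists_forall_pair_infix (h : IsBaseChoice σ C p w) (hC : IsMPrimitive σ m C)
    (hσ : ∀ a, σ a ≠ []) (a : A) :
    ∃ n, ∀ N, n ≤ N → ∃ j, [w j (-1), w j 0] <:+: power σ N a := by
  obtain ⟨i, b, hb, n, -, hn⟩ := hC.reaches a
  obtain ⟨c, hc, k, hk⟩ := h.exists_pair i
  obtain ⟨n₀, hn₀⟩ := hC.exists_forall_mem_power hσ i
  refine ⟨n + (n₀ + k), fun N hN => ⟨i, ?_⟩⟩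
  obtain ⟨t, rfl⟩ := Nat.exists_eq_add_of_le hN
  rw [show n + (n₀ + k) + t = n + (n₀ + t + k) by ring, power_add]
  refine (hk.trans ?_).trans (infix_flatMap_of_mem hn)
  rw [power_add]
  exact infix_flatMap_of_mem (hn₀ _ (by omega) b hb c hc)

theorem baseData [Finite A] (h : IsBaseChoice σ C p w) (hC : IsMPrimitive σ m C)
    (hσ : ∀ a, σ a ≠ []) (hap : IsAperiodic σ) : BaseData σ p w where
  ne_nil := hσ
  recog := recognizable_space hσ hC.language_power hC.letters hap h.pos
  preimage _ hx := exists_preimage hσ hC.language_power hC.letters h.pos hx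
  inj_left i j hij := hC.eq_of_mem (h.left_mem hC i) (hij ▸ h.left_mem hC j)
  inj_right i j hij := hC.eq_of_mem (h.right_mem hC i) (hij ▸ h.right_mem hC j)
  image_right i := by
    have h1 := (h.fixed i 1).1
    simp only [factor_one, onWord, List.flatMap_singleton] at h1
    have h2 := head?_factor (w i) 0 (List.length_pos_iff.2 (power_ne_nil hσ p (w i 0)))
    rw [h1, List.head?_eq_some_iff] at h2
    obtain ⟨v, hv⟩ := h2
    refine ⟨v, ?_, hv⟩
    rintro rfl
    exact hC.power_ne_singleton hσ h.pos (h.right_mem hC i) hv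
  image_left i := by
    have h1 := (h.fixed i 1).2
    simp only [Nat.cast_one, factor_one, onWord, List.flatMap_singleton] at h1
    have h2 := getLast?_factor (w i) (-((power σ p (w i (-1))).length : ℤ))
      (List.length_pos_iff.2 (power_ne_nil hσ p (w i (-1))))
    rw [h1, List.getLast?_eq_some_iff, neg_add_cancel, zero_sub] at h2
    obtain ⟨v, hv⟩ := h2
    refine ⟨v, ?_, hv⟩
    rintro rfl
    exact hC.power_ne_singleton hσ h.pos (h.left_mem hC i) hv
  gaps := by
    choose F hF using h.exists_forall_pair_infix hC hσ
    obtain ⟨N, hN⟩ := (Set.finite_range F).bddAbove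
    obtain ⟨M, hM⟩ := (Set.finite_range fun a => (power σ (N + 1) a).length).bddAbove
    -- At most `M` steps lead to the end of the image word covering `k`, and the next image word, of
    -- length at most `M`, contains a cut.
    refine ⟨2 * M, fun x hx k => ?_⟩
    obtain ⟨y, -, c, hc⟩ := exists_preimage hσ hC.language_power hC.letters
      (show 1 ≤ N + 1 by omega) hx
    obtain ⟨i, hi, hi'⟩ := hc.exists_index (power_ne_nil hσ _) k
    obtain ⟨j, hj⟩ := hF (y (i + 1)) (N + 1) ((hN ⟨_, rfl⟩).trans (by omega))
    rw [← hc.word, pair_infix_factor] at hj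
    obtain ⟨t, h1, h2, h3⟩ := hj
    have h4 := hc.step i
    have h5 : (power σ (N + 1) (y i)).length ≤ M := hM ⟨_, rfl⟩
    have h6 : (power σ (N + 1) (y (i + 1))).length ≤ M := hM ⟨_, rfl⟩
    exact ⟨t, by omega, by push_cast; omega, j, h3⟩

end IsBaseChoice

section FixedPoint

theorem exists_limit_of_prefix {P : ℕ → List A} (hP : ∀ n, P n <+: P (n + 1))
    (hl : ∀ n, n < (P n).length) :
    ∃ g : ℕ → A, ∀ n k, k < (P n).length → (P n)[k]? = some (g k) := by
  have hmono : ∀ {a b}, a ≤ b → P a <+: P b := by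
    intro a b hab
    induction b, hab using Nat.le_induction with
    | base => exact List.prefix_rfl
    | succ b _ ih => exact ih.trans (hP b)
  refine ⟨fun k => (P k)[k]'(hl k), fun n k hk => ?_⟩
  have h1 : ∀ {a b}, a ≤ b → k < (P a).length → (P b)[k]? = (P a)[k]? := by
    intro a b hab hka
    obtain ⟨t, ht⟩ := hmono hab
    rw [← ht, List.getElem?_append_left hka]
  rw [← List.getElem?_eq_getElem]
  rcases le_total n k with h | h
  · exact (h1 h hk).symm
  · exact h1 h (hl k)

variable {s : A → List A} {r l : A} {u v : List A}

/-- The words `sⁿ(l)` are prefixes of one another and the words `sⁿ(r)` suffixes; their limits are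
glued at the origin. -/
theorem exists_fixedPoint (hs : ∀ a, s a ≠ []) (hv : v ≠ []) (hl : s l = l :: v) (hu : u ≠ [])
    (hr : s r = u ++ [r]) : ∃ w : ℤ → A, ∀ n,
      factor w 0 (power s n l).length = power s n l ∧
      factor w (-((power s n r).length : ℤ)) (power s n r).length = power s n r ∧
      n < (power s n l).length ∧ n < (power s n r).length := by
  have hln : ∀ n, power s (n + 1) l = power s n l ++ v.flatMap (power s n) := by
    intro n
    rw [add_comm, power_add, power_one, hl, List.flatMap_cons]
  have hrn : ∀ n, power s (n + 1) r = u.flatMap (power s n) ++ power s n r := by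
    intro n
    rw [add_comm, power_add, power_one, hr, List.flatMap_append, List.flatMap_singleton]
  have hll : ∀ n, n < (power s n l).length := by
    intro n
    induction n with
    | zero => simp
    | succ n ih =>
      have := List.length_pos_iff.2 (flatMap_ne_nil (power_ne_nil hs n) hv)
      rw [hln, List.length_append]
      omega
  have hrl : ∀ n, n < (power s n r).length := by
    intro n
    induction n with
    | zero => simp
    | succ n ih =>
      have := List.length_pos_iff.2 (flatMap_ne_nil (power_ne_nil hs n) hu)
      rw [hrn, List.length_append]
      omega
  obtain ⟨g, hg⟩ := exists_limit_of_prefix (P := fun n => power s n l)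
    (fun n => ⟨_, (hln n).symm⟩) hll
  obtain ⟨g', hg'⟩ := exists_limit_of_prefix (P := fun n => (power s n r).reverse)
    (fun n => by simp only [hrn, List.reverse_append, List.prefix_append]) (by simpa using hrl)
  refine ⟨fun k => if 0 ≤ k then g k.toNat else g' (-1 - k).toNat, fun n =>
    ⟨?_, ?_, hll n, hrl n⟩⟩
  · apply List.ext_getElem?
    intro i
    rw [getElem?_factor]
    split_ifs with h1 h2
    · rw [hg n i h1]
      simp
    · omega
    · simpa using h1
  · apply List.ext_getElem?
    intro i
    rw [getElem?_factor]
    split_ifs with h1 h2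
    · omega
    · have := hg' n ((power s n r).length - 1 - i) (by rw [List.length_reverse]; omega)
      rw [List.getElem?_reverse (by omega)] at this
      rw [show (power s n r).length - 1 - ((power s n r).length - 1 - i) = i by omega] at this
      rw [this]
      congr 2
      omega
    · simpa using h1

/-- A prefix of length `n` of the right half is a prefix of `sⁿ(l)`, so its image is a prefix of
`sⁿ⁺¹(l)`, which the right half also carries; likewise on the left. -/
theorem isImage_of_factor {w : ℤ → A} (h : ∀ n,
      factor w 0 (power s n l).length = power s n l ∧
      factor w (-((power s n r).length : ℤ)) (power s n r).length = power s n r ∧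
      n < (power s n l).length ∧ n < (power s n r).length) : IsImage s w w := by
  intro n
  obtain ⟨h1, h2, h3, h4⟩ := h n
  obtain ⟨h1', h2', -, -⟩ := h (n + 1)
  rw [power_succ] at h1' h2'
  constructor
  · obtain ⟨t, ht⟩ := Nat.exists_eq_add_of_lt h3
    rw [ht, add_assoc, factor_add] at h1
    rw [← h1, List.flatMap_append] at h1'
    exact (factor_eq_append h1').1
  · obtain ⟨t, ht⟩ := Nat.exists_eq_add_of_lt h4
    rw [ht, show n + t + 1 = (t + 1) + n by ring, factor_add] at h2
    rw [show -((t + 1 + n : ℕ) : ℤ) + ((t + 1 : ℕ) : ℤ) = -(n : ℤ) by push_cast; ring] at h2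
    rw [← h2, List.flatMap_append] at h2'
    have h5 := (factor_eq_append h2').2
    rw [List.length_append] at h5
    simp only [onWord]
    convert h5 using 2
    push_cast
    ring

end FixedPoint

theorem exists_isBaseChoice [Finite A] (hσ : ∀ a, σ a ≠ []) (hC : IsMPrimitive σ m C) :
    ∃ (p : ℕ) (w : Fin m → ℤ → A), IsBaseChoice σ C p w := by
  -- The letters on the two sides of a word boundary evolve under `σ` by the self-map `f` of a
  -- finite set.
  let f : A × A → A × A := fun q => ((σ q.1).getLast (hσ _), (σ q.2).head (hσ _))
  have hf : ∀ n q, ∃ v v', power σ n q.1 = v ++ [(f^[n] q).1] ∧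
      power σ n q.2 = (f^[n] q).2 :: v' := by
    intro n q
    induction n with
    | zero => exact ⟨[], [], rfl, rfl⟩
    | succ n ih =>
      obtain ⟨v, v', h1, h2⟩ := ih
      rw [Function.iterate_succ_apply', power_succ, power_succ, h1, h2]
      refine ⟨v.flatMap σ ++ (σ (f^[n] q).1).dropLast,
        (σ (f^[n] q).2).tail ++ v'.flatMap σ, ?_, ?_⟩
      · simp [f, List.dropLast_append_getLast]
      · rw [List.flatMap_cons, ← List.cons_append]
        simp [f]
  have hpair : ∀ i, ∃ c ∈ C i, ∃ n, ∃ q : A × A, [q.1, q.2] <:+: power σ n c := by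
    intro i
    obtain ⟨a, b, ha, hb, hne⟩ := (Set.one_lt_ncard_iff (Set.toFinite (C i))).1 (hC.two_le i)
    obtain ⟨n, hn⟩ := hC.exists_forall_mem_power hσ i
    have h1 := hn n le_rfl a ha a ha
    have h2 := hn n le_rfl a ha b hb
    -- Two distinct letters occur in `σⁿ(a)`, so it contains a word of length two.
    rcases hw : power σ n a with _ | ⟨x, _ | ⟨y, t⟩⟩
    · simp [hw] at h1
    · simp only [hw, List.mem_singleton] at h1 h2
      exact absurd (h1.trans h2.symm) hne
    · exact ⟨a, ha, n, (x, y), by rw [hw]; exact ⟨[], t, rfl⟩⟩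
  -- Two iterates of `f` coincide as functions, which gives one period `p + 1` for all components at
  -- once.
  obtain ⟨N, N', hne, hNN⟩ := Finite.exists_ne_map_eq_of_infinite fun n : ℕ => f^[n]
  wlog hlt : N < N' generalizing N N'
  · exact this N' N hne.symm hNN.symm (by omega)
  obtain ⟨p, hp⟩ := Nat.exists_eq_add_of_lt hlt
  have key : ∀ i, ∃ w : ℤ → A, w ∈ component σ (C i) ∧ IsImage (power σ (p + 1)) w w := by
    intro i
    obtain ⟨c, hc, n, q, hq⟩ := hpair i
    have hfix : f^[p + 1] (f^[N] q) = f^[N] q := by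
      rw [← Function.iterate_add_apply]
      exact (congrArg (fun k => f^[k] q) (show p + 1 + N = N' by omega)).trans
        (congrFun hNN q).symm
    obtain ⟨v, v', h1, h2⟩ := hf N q
    obtain ⟨u, u', h3, h4⟩ := hf (p + 1) (f^[N] q)
    rw [hfix] at h3 h4
    set r := (f^[N] q).1
    set l := (f^[N] q).2
    have hrl : [r, l] <:+: power σ (n + N) c := by
      rw [power_add]
      refine List.IsInfix.trans ?_ (infix_flatMap hq)
      simp only [List.flatMap_cons, List.flatMap_nil, h1, h2]
      exact ⟨v, v', by simp⟩
    have hr : r ∈ C i := hC.mem_of_mem_power hc (hrl.subset (by simp))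
    have hl : l ∈ C i := hC.mem_of_mem_power hc (hrl.subset (by simp))
    obtain ⟨w, hw⟩ := exists_fixedPoint (power_ne_nil hσ (p + 1)) (v := u') (u := u) (l := l)
      (r := r) (by
        rintro rfl
        exact hC.power_ne_singleton hσ (by omega) hl h4) h4 (by
        rintro rfl
        exact hC.power_ne_singleton hσ (by omega) hr h3) h3
    have hwin : ∀ k : ℕ, factor w (-(k : ℤ)) (2 * k + 1) <:+:
        power σ (n + N + (p + 1) * (k + 1)) c := by
      intro k
      obtain ⟨h5, h6, h7, h8⟩ := hw (k + 1)
      rw [power_add, ← power_power]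
      refine List.IsInfix.trans ?_ (infix_flatMap hrl)
      simp only [List.flatMap_cons, List.flatMap_nil, List.append_nil]
      have h9 := factor_add w (-((power (power σ (p + 1)) (k + 1) r).length : ℤ))
        (power (power σ (p + 1)) (k + 1) r).length (power (power σ (p + 1)) (k + 1) l).length
      rw [neg_add_cancel, h5, h6] at h9
      rw [← h9]
      refine factor_infix w ?_ ?_
      · omega
      · push_cast
        omega
    exact ⟨w, ⟨fun k => ⟨c, _, by nlinarith, hwin k⟩, fun k => ⟨c, hc, _, hwin k⟩⟩,
      isImage_of_factor hw⟩
  choose w h1 h2 using key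
  exact ⟨p + 1, w, by omega, h1, h2⟩

end MPrimitive

/-! ### Positions of edges in the order of the diagram. -/

section EdgeLists

theorem exists_sorted_list {E : Type*} [PartialOrder E] [Finite E] (P : E → Prop)
    (hP : ∀ e f, P e → P f → e ≤ f ∨ f ≤ e) :
    ∃ es : List E, es.Pairwise (· < ·) ∧ (∀ e, e ∈ es ↔ P e) ∧
      es.length = Nat.card {e // P e} := by
  classical
  let : LinearOrder {e // P e} :=
    { (inferInstance : PartialOrder {e // P e}) with
      le_total := fun a b => hP a b a.2 b.2
      toDecidableLE := Classical.decRel _ }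
  cases nonempty_fintype {e // P e}
  let φ : Fin (Fintype.card {e // P e}) ≃o {e // P e} := monoEquivOfFin _ rfl
  refine ⟨List.ofFn fun i => (φ i : E), ?_, fun e => ?_, by simp⟩
  · rw [List.pairwise_ofFn]
    exact fun i j hij => φ.strictMono hij
  · rw [List.mem_ofFn]
    constructor
    · rintro ⟨i, rfl⟩
      exact (φ i).2
    · exact fun h => ⟨φ.symm ⟨e, h⟩, by simp⟩

variable (B : OrderedBratteliDiagram.{v}) {R : Type u} (lab : ∀ n, B.V (n + 1) ≃ R)

/-- Increasing lists of the edges with given range. -/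
structure IsEdgeLists (len : ℕ → R → ℕ) (τ : R → List R)
    (es : ∀ n, B.V (n + 1) → List (B.E n)) : Prop where
  sorted : ∀ n x, (es n x).Pairwise (· < ·)
  mem : ∀ n x e, e ∈ es n x ↔ B.rng e = x
  length : ∀ n x, (es n x).length = len n (lab n x)
  read : ∀ n x, (es (n + 1) x).map (fun e => lab n (B.src e)) = τ (lab (n + 1) x)

theorem exists_isEdgeLists {τ : R → List R} {len : ℕ → R → ℕ} (hr : B.IsRead lab τ)
    (ht : B.HasTopEdges lab (len 0)) (hlen : ∀ n a, len (n + 1) a = (τ a).length) :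
    ∃ es, IsEdgeLists B lab len τ es := by
  have key : ∀ x : B.V 1, ∃ es : List (B.E 0), es.Pairwise (· < ·) ∧
      (∀ e, e ∈ es ↔ B.rng e = x) ∧ es.length = len 0 (lab 0 x) := by
    intro x
    have := B.finite_E 0
    obtain ⟨es, h1, h2, h3⟩ := exists_sorted_list (fun e : B.E 0 => lab 0 (B.rng e) = lab 0 x)
      fun e f he hf => (B.comparable e f).2 ((lab 0).injective (he.trans hf.symm))
    exact ⟨es, h1, fun e => by rw [h2, (lab 0).injective.eq_iff], by rw [h3, ht]⟩
  choose es0 h1 h2 h3 using key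
  choose es1 h4 h5 h6 using hr
  refine ⟨fun n => match n with | 0 => es0 | n + 1 => es1 n, ?_, ?_, ?_, h6⟩
  · rintro (_ | n) x
    · exact h1 x
    · exact h4 n x
  · rintro (_ | n) x
    · exact h2 x
    · exact h5 n x
  · rintro (_ | n) x
    · exact h3 x
    · simpa [hlen] using congrArg List.length (h6 n x)

variable {B lab} {len : ℕ → R → ℕ} {τ : R → List R} {es : ∀ n, B.V (n + 1) → List (B.E n)}

namespace IsEdgeLists

variable (H : IsEdgeLists B lab len τ es)
include H

theorem lt_iff {n : ℕ} {x : B.V (n + 1)} {i j : ℕ} {e f : B.E n} (he : (es n x)[i]? = some e)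
    (hf : (es n x)[j]? = some f) : e < f ↔ i < j := by
  have hs := H.sorted n x
  rw [List.pairwise_iff_getElem] at hs
  obtain ⟨hi, rfl⟩ := List.getElem?_eq_some_iff.1 he
  obtain ⟨hj, rfl⟩ := List.getElem?_eq_some_iff.1 hf
  refine ⟨fun h => ?_, fun h => hs i j hi hj h⟩
  by_contra! hle
  rcases hle.eq_or_lt with rfl | hlt
  · exact h.false
  · exact (h.trans (hs j i hj hi hlt)).false

theorem exists_index (n : ℕ) (e : B.E n) : ∃ k : ℕ, (es n (B.rng e))[k]? = some e :=
  List.mem_iff_getElem?.1 ((H.mem n _ e).2 rfl)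

theorem rng_eq {n : ℕ} {x : B.V (n + 1)} {k : ℕ} {e : B.E n} (he : (es n x)[k]? = some e) :
    B.rng e = x := (H.mem n x e).1 (List.mem_iff_getElem?.2 ⟨k, he⟩)

theorem index_of_le {n : ℕ} {x : B.V (n + 1)} {k : ℕ} {e f : B.E n}
    (he : (es n x)[k]? = some e) (h : e ≤ f ∨ f ≤ e) : ∃ j : ℕ, (es n x)[j]? = some f := by
  have h1 := (B.comparable e f).1 h
  rw [H.rng_eq he] at h1
  exact List.mem_iff_getElem?.1 ((H.mem n x f).2 h1.symm)

theorem isMax_iff {n : ℕ} {x : B.V (n + 1)} {k : ℕ} {e : B.E n} (he : (es n x)[k]? = some e) :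
    IsMax e ↔ k + 1 = (es n x).length := by
  have hk := (List.getElem?_eq_some_iff.1 he).1
  constructor
  · intro h
    by_contra hne
    have hlt : k + 1 < (es n x).length := by omega
    have h1 := (H.lt_iff he (List.getElem?_eq_getElem hlt)).2 (by omega)
    exact h.not_lt h1
  · intro h
    rw [isMax_iff_forall_not_lt]
    intro f hf
    obtain ⟨j, hj⟩ := H.index_of_le he (Or.inl hf.le)
    have h1 := (H.lt_iff he hj).1 hf
    have h2 := (List.getElem?_eq_some_iff.1 hj).1
    omega

theorem isMin_iff {n : ℕ} {x : B.V (n + 1)} {k : ℕ} {e : B.E n} (he : (es n x)[k]? = some e) :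
    IsMin e ↔ k = 0 := by
  have hk := (List.getElem?_eq_some_iff.1 he).1
  constructor
  · intro h
    by_contra hne
    have h1 := (H.lt_iff (List.getElem?_eq_getElem (show 0 < (es n x).length by omega)) he).2
      (by omega)
    exact h.not_lt h1
  · intro h
    rw [isMin_iff_forall_not_lt]
    intro f hf
    obtain ⟨j, hj⟩ := H.index_of_le he (Or.inr hf.le)
    have h1 := (H.lt_iff hj he).1 hf
    omega

theorem covBy {n : ℕ} {x : B.V (n + 1)} {k : ℕ} {e f : B.E n} (he : (es n x)[k]? = some e)
    (hf : (es n x)[k + 1]? = some f) : e ⋖ f := by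
  refine ⟨(H.lt_iff he hf).2 (by omega), fun g hg hg' => ?_⟩
  obtain ⟨j, hj⟩ := H.index_of_le he (Or.inl hg.le)
  have h1 := (H.lt_iff he hj).1 hg
  have h2 := (H.lt_iff hj hf).1 hg'
  omega

theorem index_unique {n : ℕ} {x : B.V (n + 1)} {i j : ℕ} {e : B.E n}
    (hi : (es n x)[i]? = some e) (hj : (es n x)[j]? = some e) : i = j := by
  have h1 := (H.lt_iff hi hj).not.1 (lt_irrefl e)
  have h2 := (H.lt_iff hj hi).not.1 (lt_irrefl e)
  omega

theorem getElem?_src {n : ℕ} {x : B.V (n + 1 + 1)} {k : ℕ} {e : B.E (n + 1)}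
    (he : (es (n + 1) x)[k]? = some e) :
    (τ (lab (n + 1) x))[k]? = some (lab n (B.src e)) := by
  rw [← H.read, List.getElem?_map, he]
  rfl

end IsEdgeLists

end EdgeLists

/-! ### Topology of the path space and of `X_σ`. -/

section PathSpace

variable (B : OrderedBratteliDiagram.{v})

theorem t2Space_pathSpace : T2Space B.PathSpace := by
  refine ⟨fun x y hxy => ?_⟩
  obtain ⟨n, hn⟩ : ∃ n, x.1 n ≠ y.1 n := by
    by_contra! h
    exact hxy (Subtype.ext (funext h))
  refine ⟨{z | ∀ i < n + 1, z.1 i = x.1 i}, {z | ∀ i < n + 1, z.1 i = y.1 i},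
    .basic _ ⟨x, n + 1, rfl⟩, .basic _ ⟨y, n + 1, rfl⟩, fun _ _ => rfl, fun _ _ => rfl, ?_⟩
  rw [Set.disjoint_left]
  intro z h1 h2
  exact hn ((h1 n (by omega)).symm.trans (h2 n (by omega)))

end PathSpace

section SpaceTopology

variable {A : Type u} [TopologicalSpace A] [DiscreteTopology A] {σ : A → List A}

theorem eventually_eq_of_le_nhds {ι : Type*} {l : Filter ι} {X : ι → ℤ → A} {x : ℤ → A}
    (h : Filter.Tendsto X l (nhds x)) (k : ℤ) : ∀ᶠ n in l, X n k = x k := by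
  have h1 := (tendsto_pi_nhds.1 h) k
  rw [nhds_discrete, Filter.tendsto_pure] at h1
  exact h1

theorem isClosed_space : IsClosed (space σ) := by
  rw [isClosed_iff_ultrafilter]
  intro x U hU hs
  exact mem_space_of_limit (l := (U : Filter (ℤ → A))) (X := id) hs
    fun k => eventually_eq_of_le_nhds hU k

theorem compactSpace_space [Finite A] : CompactSpace (space σ) :=
  isCompact_iff_compactSpace.1 isClosed_space.isCompact

/-- The shift on `X_σ`. -/
def shiftHomeomorph (σ : A → List A) : space σ ≃ₜ space σ where
  toFun x := ⟨shift x.1, translate_mem_space x.2 1⟩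
  invFun x := ⟨fun k => x.1 (k + -1), translate_mem_space x.2 (-1)⟩
  left_inv x := Subtype.ext <| funext fun k => by simp [shift]
  right_inv x := Subtype.ext <| funext fun k => by simp [shift]
  continuous_toFun := by
    refine Continuous.subtype_mk (continuous_pi fun k => ?_) _
    exact (continuous_apply (k + 1)).comp continuous_subtype_val
  continuous_invFun := by
    refine Continuous.subtype_mk (continuous_pi fun k => ?_) _
    exact (continuous_apply (k + -1)).comp continuous_subtype_val

end SpaceTopology

/-! ### Coding points by paths, and the Vershik homeomorphism. -/

section Coding

variable {A : Type u} {σ : A → List A} {m p : ℕ} {w : Fin m → ℤ → A}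
  {τ : returnWords σ w → List (returnWords σ w)}
  {B : OrderedBratteliDiagram.{v}} {lab : ∀ n, B.V (n + 1) ≃ returnWords σ w}
  {es : ∀ n, B.V (n + 1) → List (B.E n)}

/-- The number of edges ending at a vertex of level `n + 1`. -/
def height (τ : returnWords σ w → List (returnWords σ w)) : ℕ → returnWords σ w → ℕ
  | 0, u => u.1.length
  | _ + 1, u => (τ u).length

/-- The path `e` runs through the vertices `d n 0`, and its edges have the positions `-c n 0`. -/
def IsCode (es : ∀ n, B.V (n + 1) → List (B.E n)) (lab : ∀ n, B.V (n + 1) ≃ returnWords σ w)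
    (e : B.PathSpace) (d : ℕ → ℤ → returnWords σ w) (c : ℕ → ℤ → ℤ) : Prop :=
  ∀ n, lab n (B.rng (e.1 n)) = d n 0 ∧ (es n (B.rng (e.1 n)))[(-c n 0).toNat]? = some (e.1 n)

theorem IsTower.step_height {x : ℤ → A} {d : ℕ → ℤ → returnWords σ w} {c : ℕ → ℤ → ℤ}
    (h : IsTower τ x d c) (n : ℕ) : c n 1 = c n 0 + height τ n (d n 0) := by
  cases n with
  | zero => simpa [height] using h.zero.step 0
  | succ n => simpa [height] using (h.succ n).step 0

theorem IsCode.edge_eq {e e' : B.PathSpace} {d d' : ℕ → ℤ → returnWords σ w} {c c' : ℕ → ℤ → ℤ}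
    (h : IsCode es lab e d c) (h' : IsCode es lab e' d' c') {n : ℕ} (hd : d n 0 = d' n 0)
    (hc : c n 0 = c' n 0) : e.1 n = e'.1 n := by
  obtain ⟨h1, h2⟩ := h n
  obtain ⟨h3, h4⟩ := h' n
  have h5 : B.rng (e.1 n) = B.rng (e'.1 n) := (lab n).injective (by rw [h1, h3, hd])
  rw [h5, hc, h4, Option.some.injEq] at h2
  exact h2.symm

variable (H : IsEdgeLists B lab (height τ) τ es)
include H

theorem IsTower.exists_isCode {x : ℤ → A} {d : ℕ → ℤ → returnWords σ w} {c : ℕ → ℤ → ℤ}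
    (h : IsTower τ x d c) : ∃ e : B.PathSpace, IsCode es lab e d c := by
  have hk : ∀ n, (-c n 0).toNat < (es n ((lab n).symm (d n 0))).length := by
    intro n
    have h1 := h.step_height n
    have h2 := (h.centered n).1
    have h3 := (h.centered n).2
    rw [H.length, Equiv.apply_symm_apply]
    omega
  have hget : ∀ n, (es n ((lab n).symm (d n 0)))[(-c n 0).toNat]? =
      some ((es n ((lab n).symm (d n 0)))[(-c n 0).toNat]'(hk n)) :=
    fun n => List.getElem?_eq_getElem (hk n)
  have hrng := fun n => H.rng_eq (hget n)
  refine ⟨⟨fun n => (es n ((lab n).symm (d n 0)))[(-c n 0).toNat]'(hk n), fun n => ?_⟩,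
    fun n => ⟨?_, ?_⟩⟩
  · rw [hrng]
    apply (lab n).injective
    rw [Equiv.apply_symm_apply]
    -- Consecutive edges fit together: the letter of `τ (d (n + 1) 0)` at position `-c (n + 1) 0` is
    -- the one at index `0` of level `n`.
    have h1 := H.getElem?_src (hget (n + 1))
    have h2 := (h.centered (n + 1)).1
    have h3 := (h.centered (n + 1)).2
    have h4 := (h.succ n).step 0
    rw [zero_add] at h4
    rw [Equiv.apply_symm_apply, (h.succ n).getElem?_word (by omega),
      show c (n + 1) 0 + ((-c (n + 1) 0).toNat : ℤ) = 0 by omega, Option.some.injEq] at h1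
    exact h1
  · simp only [hrng, Equiv.apply_symm_apply]
  · simp only [hrng]
    exact hget n

theorem IsCode.isMax_iff {x : ℤ → A} {e : B.PathSpace} {d : ℕ → ℤ → returnWords σ w}
    {c : ℕ → ℤ → ℤ} (h : IsTower τ x d c) (he : IsCode es lab e d c) (n : ℕ) :
    IsMax (e.1 n) ↔ c n 1 = 1 := by
  have h1 := h.step_height n
  have h2 := (h.centered n).1
  rw [H.isMax_iff (he n).2, H.length, (he n).1]
  omega

theorem IsCode.isMin_iff {x : ℤ → A} {e : B.PathSpace} {d : ℕ → ℤ → returnWords σ w}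
    {c : ℕ → ℤ → ℤ} (h : IsTower τ x d c) (he : IsCode es lab e d c) (n : ℕ) :
    IsMin (e.1 n) ↔ c n 0 = 0 := by
  have h2 := (h.centered n).1
  rw [H.isMin_iff (he n).2]
  omega

variable (D : BaseData σ p w) (hτ : IsDerivative σ w (power σ p) τ)
include D hτ

omit H in
theorem IsCode.of_isTower {x : ℤ → A} {e : B.PathSpace} {d d' : ℕ → ℤ → returnWords σ w}
    {c c' : ℕ → ℤ → ℤ} (h : IsTower τ x d c) (h' : IsTower τ x d' c')
    (he : IsCode es lab e d c) : IsCode es lab e d' c' := by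
  intro n
  obtain ⟨h1, h2⟩ := h.unique D hτ h' n
  rw [← h1, ← h2]
  exact he n

theorem exists_point_of_path [Finite A] (e : B.PathSpace) :
    ∃ x ∈ space σ, ∃ d c, IsTower τ x d c ∧ IsCode es lab e d c := by
  choose k hk using fun n => H.exists_index n (e.1 n)
  obtain ⟨x, hx, d, c, h, hdc⟩ := exists_isTower_of_path D hτ
    (v := fun n => lab n (B.rng (e.1 n))) (k := k) (by
      have h1 := (List.getElem?_eq_some_iff.1 (hk 0)).1
      rwa [H.length] at h1) (fun n => by
      rw [H.getElem?_src (hk (n + 1)), e.2 n])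
  refine ⟨x, hx, d, c, h, fun n => ⟨(hdc n).1.symm, ?_⟩⟩
  rw [(hdc n).2, neg_neg, Int.toNat_natCast]
  exact hk n

/-- The homeomorphism which sends a point of `X_σ` to the path of its tower. -/
theorem exists_homeomorph [Finite A] [TopologicalSpace A] [DiscreteTopology A] :
    ∃ G : space σ ≃ₜ B.PathSpace, ∀ x d c, IsTower τ x.1 d c → IsCode es lab (G x) d c := by
  have key : ∀ x : space σ, ∃ e : B.PathSpace, ∃ d c, IsTower τ x.1 d c ∧
      IsCode es lab e d c := by
    intro x
    obtain ⟨d, c, h⟩ := exists_isTower D hτ x.2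
    obtain ⟨e, he⟩ := h.exists_isCode H
    exact ⟨e, d, c, h, he⟩
  choose g d c hT hg using key
  have hinj : Function.Injective g := by
    intro x x' hxx
    have h1 := hg x
    have h2 := hg x'
    rw [hxx] at h1
    refine Subtype.ext ((hT x).injective D hτ (hT x') (fun n => ?_) fun n => ?_)
    · rw [← (h1 n).1, (h2 n).1]
    · have h3 := H.index_unique (h1 n).2 (h2 n).2
      have h4 := ((hT x).centered n).1
      have h5 := ((hT x').centered n).1
      omega
  have hsurj : Function.Surjective g := by
    intro e
    obtain ⟨x, hx, d', c', h, he⟩ := exists_point_of_path H D hτ e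
    have h1 := (hg ⟨x, hx⟩).of_isTower D hτ (hT _) h
    exact ⟨⟨x, hx⟩, Subtype.ext (funext fun n => h1.edge_eq he rfl rfl)⟩
  have hcont : Continuous g := by
    rw [continuous_iff_ultrafilter]
    intro x U hU
    rw [TopologicalSpace.tendsto_nhds_generateFrom_iff]
    rintro _ ⟨y, n, rfl⟩ hy
    have hX : ∀ k, ∀ᶠ z in (U : Filter (space σ)), z.1 k = x.1 k := fun k =>
      eventually_eq_of_le_nhds (X := Subtype.val)
        ((continuous_subtype_val.tendsto x).mono_left hU) k
    have h1 := fun l => IsTower.limit D hτ hT (hT x) hX l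
    have h2 : ∀ᶠ z in (U : Filter (space σ)), ∀ i ∈ Finset.range n,
        d z i 0 = d x i 0 ∧ c z i 0 = c x i 0 :=
      (Filter.eventually_all_finset _).2 fun i _ => ((h1 i).1 0).and ((h1 i).2 0)
    filter_upwards [h2] with z hz i hi
    rw [← hy i hi]
    have h3 := hz i (Finset.mem_range.2 hi)
    exact (hg z).edge_eq (hg x) h3.1 h3.2
  have := t2Space_pathSpace B
  have := compactSpace_space (σ := σ)
  refine ⟨Continuous.homeoOfEquivCompactToT2 (f := Equiv.ofBijective g ⟨hinj, hsurj⟩) hcont,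
    fun x d' c' h => ?_⟩
  exact (hg x).of_isTower D hτ (hT x) h

/-- The Vershik homeomorphism, conjugate to the shift. -/
theorem exists_isVershik [Finite A] [TopologicalSpace A] [DiscreteTopology A] :
    ∃ φ : B.PathSpace ≃ₜ B.PathSpace, B.IsVershik φ ∧
      ∃ h : B.PathSpace ≃ₜ space σ, ∀ x, (h (φ x)).1 = shift (h x).1 := by
  obtain ⟨G, hG⟩ := exists_homeomorph H D hτ
  let φ : B.PathSpace ≃ₜ B.PathSpace := (G.symm.trans (shiftHomeomorph σ)).trans G
  have key : ∀ e, ∃ x y d c d' c', IsTower τ x d c ∧ IsCode es lab e d c ∧ IsTower τ y d' c' ∧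
      IsCode es lab (φ e) d' c' ∧ ∀ n,
      ((∀ i < n, c i 1 = 1) → c n 1 = 1 → c' n 0 = 0) ∧
      ((∀ i < n, c i 1 = 1) → c n 1 ≠ 1 → d' n = d n ∧ c' n 0 = c n 0 - 1) ∧
      ((∃ i < n, c i 1 ≠ 1) → d' n = d n ∧ c' n = c n) := by
    intro e
    obtain ⟨d, c, h⟩ := exists_isTower D hτ (G.symm e).2
    obtain ⟨d', c', h', hs⟩ := h.shift hτ
    have h1 := hG _ _ _ h
    rw [G.apply_symm_apply] at h1
    exact ⟨_, _, d, c, d', c', h, h1, h', hG (shiftHomeomorph σ (G.symm e)) _ _ h', hs⟩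
  have hstep : ∀ (x : B.PathSpace) (k : ℕ), (∀ i < k, IsMax (x.1 i)) → ¬ IsMax (x.1 k) →
      (∀ i < k, IsMin ((φ x).1 i)) ∧ x.1 k ⋖ (φ x).1 k ∧ ∀ i, k < i → (φ x).1 i = x.1 i := by
    intro e k hmax hk
    obtain ⟨x, y, d, c, d', c', h, he, h', he', hs⟩ := key e
    have hc : ∀ i < k, c i 1 = 1 := fun i hi => (he.isMax_iff H h i).1 (hmax i hi)
    have hck : c k 1 ≠ 1 := fun h1 => hk ((he.isMax_iff H h k).2 h1)
    refine ⟨fun i hi => ?_, ?_, fun i hi => ?_⟩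
    · exact (he'.isMin_iff H h' i).2 ((hs i).1 (fun j hj => hc j (hj.trans hi)) (hc i hi))
    · obtain ⟨h1, h2⟩ := (hs k).2.1 hc hck
      obtain ⟨h3, h4⟩ := he k
      obtain ⟨h5, h6⟩ := he' k
      have h7 : B.rng ((φ e).1 k) = B.rng (e.1 k) := (lab k).injective (by rw [h3, h5, h1])
      have h8 := (h.centered k).1
      rw [h7, h2, show (-(c k 0 - 1)).toNat = (-c k 0).toNat + 1 by omega] at h6
      exact H.covBy h4 h6
    · obtain ⟨h1, h2⟩ := (hs i).2.2 ⟨k, hi, hck⟩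
      exact he'.edge_eq he (by rw [h1]) (by rw [h2])
  refine ⟨φ, ⟨?_, hstep⟩, G.symm, fun x => ?_⟩
  · ext e'
    constructor
    · rintro ⟨e, hmax, rfl⟩ n
      obtain ⟨x, y, d, c, d', c', h, he, h', he', hs⟩ := key e
      have hc : ∀ i, c i 1 = 1 := fun i => (he.isMax_iff H h i).1 (hmax i)
      exact (he'.isMin_iff H h' n).2 ((hs n).1 (fun i _ => hc i) (hc n))
    · intro hmin
      refine ⟨φ.symm e', ?_, φ.apply_symm_apply e'⟩
      -- If the preimage were not maximal, the edge of `e'` at its first non-maximal level would be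
      -- a successor and hence not minimal.
      by_contra hcon
      simp only [OrderedBratteliDiagram.maxPaths, Set.mem_ofPred_eq, not_forall] at hcon
      classical
      have h1 := hstep (φ.symm e') (Nat.find hcon)
        (fun i hi => not_not.1 (Nat.find_min hcon hi)) (Nat.find_spec hcon)
      rw [φ.apply_symm_apply] at h1
      exact (hmin _).not_lt h1.2.1.lt
  · have : G.symm (φ x) = shiftHomeomorph σ (G.symm x) := G.symm_apply_apply _
    rw [this]
    rfl

end Coding

/-! ### Construction of the diagram. -/

section Existence

variable {R : Type u} [Finite R] [Nonempty R]

/-- The stationary ordered Bratteli diagram on which a substitution is read. -/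
theorem exists_diagram (τ : R → List R) (hτ : ∀ a, τ a ≠ []) (hsurj : ∀ a, ∃ b, a ∈ τ b)
    (h : R → ℕ) (hh : ∀ a, 0 < h a) :
    ∃ (B : OrderedBratteliDiagram.{v}) (lab : ∀ n, B.V (n + 1) ≃ R),
      B.IsRead lab τ ∧ B.HasTopEdges lab h := by
  -- The labels live in universe `u` and the diagram in `v`, so vertices are modelled on lifted
  -- copies of `Fin N`.
  let N := Nat.card R
  let ε : R ≃ Fin N := Finite.equivFin R
  let len : ℕ → Fin N → ℕ := fun n a => match n with
    | 0 => h (ε.symm a)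
    | _ + 1 => (τ (ε.symm a)).length
  have hlen : ∀ n a, 0 < len n a := by
    rintro (_ | n) a
    · exact hh _
    · exact List.length_pos_iff.2 (hτ _)
  let V : ℕ → Type v := fun n => match n with
    | 0 => PUnit
    | _ + 1 => ULift (Fin N)
  let E : ℕ → Type v := fun n => ULift (Σ a : Fin N, Fin (len n a))
  let B : OrderedBratteliDiagram.{v} :=
    { V := V
      E := E
      src := fun {n} => match n with
        | 0 => fun _ => PUnit.unit
        | _ + 1 => fun e => ⟨ε ((τ (ε.symm e.down.1)).get e.down.2)⟩
      rng := fun e => ⟨e.down.1⟩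
      finite_V := by
        rintro (_ | n)
        · exact inferInstanceAs (Finite PUnit)
        · exact inferInstanceAs (Finite (ULift (Fin N)))
      finite_E := fun n => inferInstanceAs (Finite (ULift (Σ a : Fin N, Fin (len n a))))
      top := ⟨⟨PUnit.unit⟩, inferInstanceAs (Subsingleton PUnit)⟩
      src_surjective := by
        rintro (_ | n) x
        · obtain ⟨a⟩ := ‹Nonempty R›
          exact ⟨⟨⟨ε a, ⟨0, hlen 0 _⟩⟩⟩, rfl⟩
        · obtain ⟨b, hb⟩ := hsurj (ε.symm x.down)
          rw [← ε.symm_apply_apply b] at hb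
          obtain ⟨i, hi⟩ := List.mem_iff_get.1 hb
          refine ⟨⟨⟨ε b, i⟩⟩, ?_⟩
          apply ULift.ext
          exact (congrArg ε hi).trans (ε.apply_symm_apply _)
      rng_surjective := fun n x => ⟨⟨⟨x.down, ⟨0, hlen n _⟩⟩⟩, rfl⟩
      -- In the disjoint-sum order on the sigma type two edges are comparable exactly when their
      -- ranges agree.
      order := fun n => inferInstanceAs (PartialOrder (ULift (Σ a : Fin N, Fin (len n a))))
      comparable := by
        rintro n ⟨⟨a, i⟩⟩ ⟨⟨b, j⟩⟩
        change ((⟨a, i⟩ : Σ a : Fin N, Fin (len n a)) ≤ ⟨b, j⟩ ∨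
          (⟨b, j⟩ : Σ a : Fin N, Fin (len n a)) ≤ ⟨a, i⟩) ↔ (⟨a⟩ : ULift (Fin N)) = ⟨b⟩
        constructor
        · rintro (hle | hle)
          · obtain ⟨h1, -⟩ := Sigma.le_def.1 hle
            exact congrArg _ h1
          · obtain ⟨h1, -⟩ := Sigma.le_def.1 hle
            exact congrArg _ h1.symm
        · intro hab
          obtain rfl : a = b := congrArg ULift.down hab
          rw [Sigma.mk_le_mk_iff, Sigma.mk_le_mk_iff]
          exact le_total i j }
  refine ⟨B, fun n => Equiv.ulift.trans ε.symm, fun n x => ?_, fun a => ?_⟩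
  · refine ⟨(List.finRange (len (n + 1) x.down)).map fun i => ⟨⟨x.down, i⟩⟩, ?_, fun e => ?_, ?_⟩
    · rw [List.pairwise_map]
      refine (List.pairwise_lt_finRange _).imp fun {i j} hij => ?_
      change (⟨x.down, i⟩ : Σ a : Fin N, Fin (len (n + 1) a)) < ⟨x.down, j⟩
      exact Sigma.mk_lt_mk_iff.2 hij
    · rw [List.mem_map]
      constructor
      · rintro ⟨i, -, rfl⟩
        rfl
      · rintro rfl
        exact ⟨e.down.2, List.mem_finRange _, rfl⟩
    · rw [List.map_map]
      refine Eq.trans (List.map_congr_left fun i _ => ?_) (List.map_get_finRange _)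
      exact ε.symm_apply_apply _
  · have e : {e : B.E 0 // (Equiv.ulift.trans ε.symm : B.V 1 ≃ R) (B.rng e) = a} ≃ Fin (h a) :=
      { toFun := fun e => ⟨e.1.down.2.1, by
          have h1 := e.1.down.2.2
          have h2 : ε.symm e.1.down.1 = a := e.2
          exact h1.trans_eq (congrArg h h2)⟩
        invFun := fun i => ⟨⟨⟨ε a, ⟨i.1, by
          change i.1 < h (ε.symm (ε a))
          rw [ε.symm_apply_apply]
          exact i.2⟩⟩⟩, ε.symm_apply_apply a⟩
        left_inv := by
          rintro ⟨⟨⟨b, i⟩⟩, hb⟩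
          have h2 : ε.symm b = a := hb
          subst h2
          apply Subtype.ext
          apply ULift.ext
          have h3 := ε.apply_symm_apply b
          refine Sigma.ext h3 ?_
          exact (Fin.heq_ext_iff (congrArg (len 0) h3)).2 rfl
        right_inv := fun i => rfl }
    rw [Nat.card_congr e, Nat.card_fin]

end Existence

end BratteliSubst

/-! ### Assembly of the theorem. -/

open BratteliSubst
theorem mainTheorem7 {A : Type u} [Finite A] [TopologicalSpace A] [DiscreteTopology A]
    (σ : A → List A) (hσ : IsSubstitution σ) (hap : IsAperiodic σ)
    (m : ℕ) (C : Fin m → Set A) (hC : IsMPrimitive σ m C) :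
    (∃ (p : ℕ) (w : Fin m → ℤ → A), IsBaseChoice σ C p w) ∧
    ∀ (p : ℕ) (w : Fin m → ℤ → A), IsBaseChoice σ C p w →
      (returnWords σ w).Finite ∧
      (∃! τ : returnWords σ w → List (returnWords σ w), IsDerivative σ w (power σ p) τ) ∧
      ∀ τ : returnWords σ w → List (returnWords σ w), IsDerivative σ w (power σ p) τ →
        (∃ (B : OrderedBratteliDiagram.{v}) (lab : ∀ n, B.V (n + 1) ≃ returnWords σ w),
          B.IsRead lab τ ∧ B.HasTopEdges lab (fun u => u.1.length)) ∧
        ∀ (B : OrderedBratteliDiagram.{v}) (lab : ∀ n, B.V (n + 1) ≃ returnWords σ w),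
          B.IsRead lab τ → B.HasTopEdges lab (fun u => u.1.length) →
          ∃ φ : B.PathSpace ≃ₜ B.PathSpace, B.IsVershik φ ∧
            ∃ h : B.PathSpace ≃ₜ space σ, ∀ x, (h (φ x)).1 = shift (h x).1 := by
  refine ⟨exists_isBaseChoice hσ hC, fun p w hw => ?_⟩
  have D := hw.baseData hC hσ hap
  have hfin := D.finite_returnWords
  obtain ⟨τ₀, hτ₀⟩ := D.exists_derivative
  refine ⟨hfin, ⟨τ₀, hτ₀, fun τ hτ => hτ.unique hτ₀⟩, fun τ hτ => ⟨?_, fun B lab hr ht => ?_⟩⟩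
  · have : Finite (returnWords σ w) := hfin
    have : Nonempty (returnWords σ w) := by
      obtain ⟨d, c, -⟩ := D.exists_returnParse (hw.mem ⟨0, hC.pos⟩).1
      exact ⟨d 0⟩
    refine exists_diagram τ hτ.ne_nil (fun u => ?_) _
      fun u => List.length_pos_iff.2 (returnWords_ne_nil u)
    -- Every vertex must be the source of an edge: a return-word sequence with `u` at index `0` has
    -- a `τ`-preimage, and `u` lies in the image of the word covering that index.
    obtain ⟨x, hx, d, c, h, rfl⟩ := D.exists_returnParse_of_returnWord u
    obtain ⟨d', -, e, he⟩ := D.exists_preimage_returnSpace hτ ⟨x, hx, c, h⟩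
    obtain ⟨i, hi, hi'⟩ := he.exists_index hτ.ne_nil 0
    have h1 := he.step i
    have h2 := he.getElem?_word (i := i) (j := (-e i).toNat) (by omega)
    rw [show e i + ((-e i).toNat : ℤ) = 0 by omega] at h2
    exact ⟨d' i, List.mem_of_getElem? h2⟩
  · obtain ⟨es, hes⟩ := exists_isEdgeLists B lab (len := height τ) hr ht fun _ _ => rfl
    exact exists_isVershik hes D hτ
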